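/- Let $p$ be a prime, $\kappa$ a perfect field of characteristic $p$, $K_0=\kappa((t))$ with $t$-adic valuation $v_0$ and valuation ring $\mathfrak O_0=\kappa[[t]]$. Let $K_2/K_0$ be a fully ramified cyclic Galois extension of degree $p^2$ with group $G=\langle\sigma_1\rangle$, and put $\sigma_2=\sigma_1^p$. Let $v_2$ be the normalized valuation of $K_2$, $\mathfrak O_2=\{x\in K_2: v_2(x)\ge 0\}$, $\pi$ an element with $v_2(\pi)=1$, and let $b_i=v_2((\sigma_i-1)\pi)-1$ ($i=1,2$) be the lower ramification numbers. Let $\beta_1,\beta_2\in K_0$ and $x_1,x_2\in K_2$ be Artin–Schreier–Witt data for $K_2/K_0$: with $\wp(X)=X^p-X$ and $W(x,y)=\frac{x^p+y^p-(x+y)^p}{p}=-\sum_{i=1}^{p-1}\frac1p\binom pi x^iy^{p-i}$, $$\wp(x_1)=\beta_1,\quad \wp(x_2)=W(x_1,\beta_1)+\beta_2,\quad (\sigma_1-1)x_1=1,\quad (\sigma_1-1)x_2=W(x_1,1),$$ where $\beta_1$ has maximal valuation in $\beta_1+\wp(K_0)$ and $\beta_2$ has maximal valuation in $\beta_2+\mathbb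 F_p\beta_1+\wp(K_0)$. Suppose $\beta_2=\mu^p\beta_1+\epsilon$ with $\mu,\epsilon\in K_0$, where either $\epsilon\in\kappa$, or $v_0(\epsilon)=-e<0$ with $p\nmid e$ and $e\not\equiv b_1 \pmod p$. Assume $$v_0(\epsilon)>v_0(\beta_2)+\tfrac{(p-1)b_1}{p}\quad\text{and}\quad v_0(\beta_1^p)>v_0(\beta_2)+\tfrac{(p-1)b_1}{p}.$$ In $K_0[G]$ put $\Psi_2=\sigma_2-1$ and $\Psi_1=\sigma_1\sum_{i=0}^{p-1}\binom{\mu}{i}(\sigma_2-1)^i-1$. For $0\le a<p^2$ write $a=a_{(0)}+a_{(1)}p$ with $0\le a_{(0)},a_{(1)}<p$, and set $$\Psi^{(a)}=\Psi_2^{a_{(1)}}\Psi_1^{a_{(0)}},\quad \mathfrak b(a)=(1+a_{(1)})b_2+a_{(0)}pb_1,\quad d_a=\lfloor \mathfrak b(a)/p^2\rfloor,$$ and for $0\le j<p^2$ set $w_j=\min\{d_{j+a}-d_a: 0\le a\le j+a<p^2\}$. Let $\mathfrak A=\{\alpha\in K_0[G]:\alpha\mathfrak O_2\subseteq\mathfrak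 O_2\}$ be the associated order of $\mathfrak O_2$. Then $\{t^{-w_j}\Psi^{(j)}\}_{0\le j<p^2}$ is an $\mathfrak O_0$-basis of $\mathfrak A$. Moreover, $\mathfrak O_2$ is a free $\mathfrak A$-module if and only if $w_j=d_j-d_0$ for all $0\le j<p^2$; and in this case every $\rho_*\in K_2$ with $v_2(\rho_*)=r(b_2)$, the least nonnegative residue of $b_2$ modulo $p^2$, is a free generator of $\mathfrak O_2$ over $\mathfrak A$ (that is, $\rho_*\in\mathfrak O_2$ and $\alpha\mapsto\alpha\rho_*$ is a bijection $\mathfrak A\to\mathfrak O_2$). -/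

import Mathlib

open scoped LaurentSeries PowerSeries

noncomputable section

namespace GaloisScaffold

section FieldExtension

variable {K L : Type*} [Field K] [Field L] [Algebra K L]

/-- The action of the group algebra `K[G]`, `G = Gal(L/K)`, on `L`:
the `K`-linear extension of `σ ↦ σ`. -/
def action : MonoidAlgebra K (L ≃ₐ[K] L) →ₐ[K] Module.End K L :=
  MonoidAlgebra.lift K (Module.End K L) (L ≃ₐ[K] L) (DistribMulAction.toModuleEnd K L)

/-- The group element `σ`, seen in `K[G]`. -/
def grp (σ : L ≃ₐ[K] L) : MonoidAlgebra K (L ≃ₐ[K] L) := MonoidAlgebra.of K (L ≃ₐ[K] L) σ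

theorem action_grp (σ : L ≃ₐ[K] L) (x : L) : action (grp σ) x = σ x := by
  simp [action, grp]

/-- The valuation ring `{x ∈ L : v x ≥ 0}`. -/
def valRing (v : AddValuation L (WithTop ℤ)) : Subring L where
  carrier := {x | 0 ≤ v x}
  mul_mem' {a b} ha hb := by
    change 0 ≤ v (a * b)
    rw [v.map_mul]
    exact add_nonneg ha hb
  one_mem' := by simp
  add_mem' {a b} ha hb := v.map_le_add ha hb
  zero_mem' := by simp
  neg_mem' {a} ha := by simpa using ha

/-- The associated order `{α ∈ K[G] : α • 𝔒 ⊆ 𝔒}` of the valuation ring `𝔒` of `v`. -/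
def associatedOrder (K : Type*) {L : Type*} [Field K] [Field L] [Algebra K L]
    (v : AddValuation L (WithTop ℤ)) : Subring (MonoidAlgebra K (L ≃ₐ[K] L)) where
  carrier := {α | ∀ x ∈ valRing v, action α x ∈ valRing v}
  mul_mem' {α β} hα hβ x hx := by
    rw [map_mul]
    exact hα _ (hβ x hx)
  one_mem' x hx := by simpa using hx
  add_mem' {α β} hα hβ x hx := by
    rw [map_add]
    exact add_mem (hα x hx) (hβ x hx)
  zero_mem' x hx := by simp
  neg_mem' {α} hα x hx := by
    rw [map_neg]
    exact neg_mem (hα x hx)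

/-- The valuation ring as a module over its associated order. -/
instance (v : AddValuation L (WithTop ℤ)) : Module (associatedOrder K v) (valRing v) where
  smul α x := ⟨action (α : MonoidAlgebra K (L ≃ₐ[K] L)) (x : L), α.2 x x.2⟩
  one_smul x := Subtype.ext (by change action 1 (x : L) = x; simp)
  mul_smul α β x := Subtype.ext (by
    change action ((α : MonoidAlgebra K (L ≃ₐ[K] L)) * (β : MonoidAlgebra K (L ≃ₐ[K] L)))
      (x : L) = action _ (action _ _)
    simp)
  smul_zero α := Subtype.ext (by change action _ (0 : L) = 0; simp)
  smul_add α x y := Subtype.ext (by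
    change action _ ((x : L) + y) = action _ _ + action _ _
    simp)
  add_smul α β x := Subtype.ext (by
    change action ((α : MonoidAlgebra K (L ≃ₐ[K] L)) + (β : MonoidAlgebra K (L ≃ₐ[K] L)))
      (x : L) = action _ _ + action _ _
    simp)
  zero_smul x := Subtype.ext (by change action 0 (x : L) = 0; simp)

theorem coe_smul (v : AddValuation L (WithTop ℤ)) (α : associatedOrder K v) (x : valRing v) :
    ((α • x : valRing v) : L) = action (α : MonoidAlgebra K (L ≃ₐ[K] L)) (x : L) := rfl

/-- The binomial coefficient `y (y - 1) ⋯ (y - i + 1) / i!`; it is used in characteristic `p`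
with `i < p` only, where `i!` is invertible. -/
def binom (y : K) (i : ℕ) : K := (∏ k ∈ Finset.range i, (y - k)) / (i.factorial : K)

/-- Truncated exponentiation `g^[y] = ∑_{i < p} binom(y, i) (g - 1)^i`. -/
def truncPow (p : ℕ) {A : Type*} [Ring A] [Algebra K A] (g : A) (y : K) : A :=
  ∑ i ∈ Finset.range p, binom y i • (g - 1) ^ i

/-- `Ψ₁ = σ₁ σ₂^[μ] - 1`. -/
def Psi₁ (p : ℕ) (σ₁ σ₂ : L ≃ₐ[K] L) (μ : K) : MonoidAlgebra K (L ≃ₐ[K] L) :=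
  grp σ₁ * truncPow p (grp σ₂) μ - 1

/-- `Ψ₂ = σ₂ - 1`. -/
def Psi₂ (σ₂ : L ≃ₐ[K] L) : MonoidAlgebra K (L ≃ₐ[K] L) := grp σ₂ - 1

/-- `Ψ^(a) = Ψ₂^{a₁} Ψ₁^{a₀}` for `a = a₀ + a₁ p < p²` with digits `0 ≤ a₀, a₁ < p`. -/
def Psi (p : ℕ) (σ₁ σ₂ : L ≃ₐ[K] L) (μ : K) (a : ℕ) : MonoidAlgebra K (L ≃ₐ[K] L) :=
  Psi₂ σ₂ ^ (a / p) * Psi₁ p σ₁ σ₂ μ ^ (a % p)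

end FieldExtension

/-- The polynomial `(x^p + y^p - (x + y)^p) / p = -∑_{i=1}^{p-1} (1/p) binom(p, i) x^i y^{p-i}`
with integer coefficients, evaluated at `x, y`. -/
def wittPoly {R : Type*} [CommRing R] (p : ℕ) (x y : R) : R :=
  -∑ i ∈ Finset.Ico 1 p, ((p.choose i / p : ℕ) : R) * x ^ i * y ^ (p - i)

/-- `v` is the normalized valuation of the finite extension `L` of `κ((t))` (with value group `ℤ`,
and extending a multiple of the `t`-adic valuation) and `L / κ((t))` is fully ramified, i.e. the
ramification index is the degree. -/
structure IsFullyRamifiedValuation (κ : Type*) {L : Type*} [Field κ] [Field L] [Algebra κ⸨X⸩ L]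
    (v : AddValuation L (WithTop ℤ)) : Prop where
  normalized : ∀ n : ℤ, ∃ x : L, v x = n
  ramification : ∀ a : κ⸨X⸩, v (algebraMap κ⸨X⸩ L a) = Module.finrank κ⸨X⸩ L • a.orderTop

/-- `𝔟(a) = (1 + a₁) b₂ + a₀ p b₁` for `a = a₀ + a₁ p < p²` with digits `0 ≤ a₀, a₁ < p`. -/
def bb (p : ℕ) (b₁ b₂ : ℤ) (a : ℕ) : ℤ :=
  (1 + ((a / p : ℕ) : ℤ)) * b₂ + ((a % p : ℕ) : ℤ) * p * b₁

/-- `d_a = ⌊𝔟(a) / p²⌋`. -/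
def dd (p : ℕ) (b₁ b₂ : ℤ) (a : ℕ) : ℤ := ⌊(bb p b₁ b₂ a : ℚ) / (p : ℚ) ^ 2⌋

/-- `w_j = min {d_{j+a} - d_a : 0 ≤ a ≤ j + a < p²}`, for `0 ≤ j < p²`. -/
def ww (p : ℕ) (b₁ b₂ : ℤ) (j : Fin (p ^ 2)) : ℤ :=
  (Finset.range (p ^ 2 - j)).inf' (by have := j.2; simp; omega)
    (fun a => dd p b₁ b₂ (j + a) - dd p b₁ b₂ a)

end GaloisScaffold

end

/-!
The reduced Witt vector yields `x = x₁` and `y = x₂ - μ x₁` with `v x = -p b₁` and `v y = -b₂`,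
such that `σ₂` fixes `x` and maps `y` to `y + 1`, while `σ₁ σ₂^[μ]` maps `x` to `x + 1` and moves
`y` only by an error term of large value. Hence `Ψ₂` and `Ψ₁` lower the indices of the products
`binom y i * binom x j`, exactly in the first case and up to higher values in the second. The
values of these `p²` products are incongruent modulo `p²`, so `Ψ₂` and `Ψ₁` raise values by
exactly `b₂` and `p b₁`, as long as no index is `0`.

In characteristic `p` moreover `Ψ₁ ^ p = Ψ₂` and `Ψ₁ ^ (p ^ 2) = 0`, so that `Ψ^(a) = Ψ₁ ^ a` and
`K[G] = K[Ψ₁]` consists of truncated polynomials. If `v ρ = r(b₂)`, the elements `Ψ₁ ^ a ρ` have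
incongruent values as well, which turns the integrality of `P(Ψ₁) ρ` and the membership of `P(Ψ₁)`
in the associated order into bounds for the coefficients of `P`. Finally, if `Q(Ψ₁) ρ` is a free
generator, then `Q` has a nonzero constant coefficient; comparing lowest coefficients in the
products `P Q` that represent the multiples of `Ψ₁ ^ j ρ` generating them over `𝔒₀` forces
`w_j = d_j - d_0`.
-/

noncomputable section

namespace GaloisScaffold

section AddVal

variable {L : Type*} [Field L] {v : AddValuation L (WithTop ℤ)}

theorem exists_val_eq {x : L} (hx : x ≠ 0) : ∃ k : ℤ, v x = (k : WithTop ℤ) := by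
  obtain ⟨k, hk⟩ := WithTop.ne_top_iff_exists.1 (v.ne_top_iff.2 hx)
  exact ⟨k, hk.symm⟩

theorem ne_zero_of_val_eq {x : L} {k : ℤ} (hx : v x = k) : x ≠ 0 := by
  rintro rfl
  simp at hx

theorem coe_lt_iff {k : ℤ} {w : WithTop ℤ} :
    (k : WithTop ℤ) < w ↔ ((k + 1 : ℤ) : WithTop ℤ) ≤ w := by
  cases w with
  | top => simp
  | coe w => norm_cast

theorem le_val_mul {x y : L} {a b : ℤ} (hx : (a : WithTop ℤ) ≤ v x) (hy : (b : WithTop ℤ) ≤ v y) :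
    ((a + b : ℤ) : WithTop ℤ) ≤ v (x * y) := by
  rw [v.map_mul, WithTop.coe_add]
  exact add_le_add hx hy

theorem val_mul_eq {x y : L} {a b : ℤ} (hx : v x = a) (hy : v y = b) :
    v (x * y) = ((a + b : ℤ) : WithTop ℤ) := by
  rw [v.map_mul, WithTop.coe_add, hx, hy]

theorem le_val_prod {ι : Type*} {s : Finset ι} {f : ι → L} {a : ι → ℤ}
    (h : ∀ i ∈ s, (a i : WithTop ℤ) ≤ v (f i)) :
    ((∑ i ∈ s, a i : ℤ) : WithTop ℤ) ≤ v (∏ i ∈ s, f i) := by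
  classical
  induction s using Finset.induction_on with
  | empty => simp
  | insert i s hi ih =>
    rw [Finset.prod_insert hi, Finset.sum_insert hi]
    exact le_val_mul (h i (by simp)) (ih fun j hj => h j (by simp [hj]))

theorem val_prod_eq {ι : Type*} {s : Finset ι} {f : ι → L} {a : ι → ℤ}
    (h : ∀ i ∈ s, v (f i) = a i) :
    v (∏ i ∈ s, f i) = ((∑ i ∈ s, a i : ℤ) : WithTop ℤ) := by
  classical
  induction s using Finset.induction_on with
  | empty => simp
  | insert i s hi ih =>
    rw [Finset.prod_insert hi, Finset.sum_insert hi]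
    exact val_mul_eq (h i (by simp)) (ih fun j hj => h j (by simp [hj]))

theorem val_pow_eq {x : L} {a : ℤ} (hx : v x = a) (k : ℕ) :
    v (x ^ k) = ((k * a : ℤ) : WithTop ℤ) := by
  rw [v.map_pow, hx, ← WithTop.coe_nsmul, nsmul_eq_mul]

theorem le_val_pow {x : L} {a : ℤ} (hx : (a : WithTop ℤ) ≤ v x) (k : ℕ) :
    ((k * a : ℤ) : WithTop ℤ) ≤ v (x ^ k) := by
  simpa using le_val_prod (s := Finset.range k) (a := fun _ => a) fun _ _ => hx

theorem val_natCast_nonneg (k : ℕ) : 0 ≤ v (k : L) :=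
  natCast_mem (valRing v) k

theorem val_add_eq {x y : L} {a : ℤ} (hx : v x = a) (hy : ((a + 1 : ℤ) : WithTop ℤ) ≤ v y) :
    v (x + y) = a := by
  rw [v.map_add_eq_of_lt_left (by rwa [hx, coe_lt_iff]), hx]

theorem val_sub_eq {x y : L} {a : ℤ} (hx : v x = a) (hy : ((a + 1 : ℤ) : WithTop ℤ) ≤ v y) :
    v (x - y) = a := by
  rw [sub_eq_add_neg]
  exact val_add_eq hx (by rwa [v.map_neg])

theorem one_le_val_of_pow_eq_sum {x : L} {n : ℕ} {a : Fin n → L} (ha : ∀ i, 1 ≤ v (a i))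
    (h : x ^ n = ∑ i, a i * x ^ (i : ℕ)) : 1 ≤ v x := by
  rcases eq_or_ne x 0 with rfl | hx
  · simp
  obtain ⟨k, hk⟩ := exists_val_eq (v := v) hx
  by_contra! hk1
  have hk0 : k ≤ 0 := by
    rw [hk] at hk1
    exact Int.lt_add_one_iff.1 (by exact_mod_cast hk1)
  have hsum : ((1 + (n - 1) * k : ℤ) : WithTop ℤ) ≤ v (x ^ n) := by
    rw [h]
    refine v.map_le_sum fun i _ => ?_
    refine le_trans ?_ (le_val_mul (a := 1) (ha i) (le_val_pow hk.ge i))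
    have hi : (i : ℤ) + 1 ≤ n := by exact_mod_cast i.2
    exact_mod_cast (by nlinarith : (1 + (n - 1) * k : ℤ) ≤ 1 + (i : ℕ) * k)
  rw [val_pow_eq hk] at hsum
  have : 1 + (n - 1) * k ≤ n * k := by exact_mod_cast hsum
  linarith

theorem le_val_one_add_pow_sub_one {w : L} {b : ℤ} (hb : 0 ≤ b) (hw : (b : WithTop ℤ) ≤ v w)
    (i : ℕ) : (b : WithTop ℤ) ≤ v ((1 + w) ^ i - 1) := by
  have hw0 : ((0 : ℤ) : WithTop ℤ) ≤ v (1 + w) :=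
    v.map_le_add (by simp) (le_trans (by exact_mod_cast hb) hw)
  rw [← geom_sum_mul, add_sub_cancel_left]
  have hsum : ((0 : ℤ) : WithTop ℤ) ≤ v (∑ j ∈ Finset.range i, (1 + w) ^ j) :=
    v.map_le_sum fun j _ => by simpa using le_val_pow hw0 j
  simpa using le_val_mul hsum hw

theorem val_one_add_pow_sub_one {w : L} {b : ℤ} (hb : 1 ≤ b) (hw : v w = b) {i : ℕ}
    (hi : v (i : L) = 0) : v ((1 + w) ^ i - 1) = b := by
  have hquad : ((b + 1 : ℤ) : WithTop ℤ) ≤ v ((1 + w) ^ i - 1 - i * w) := by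
    clear hi
    induction i with
    | zero => simp
    | succ i ih =>
      rw [show (1 + w) ^ (i + 1) - 1 - ((i + 1 : ℕ) : L) * w =
        (1 + w) ^ i - 1 - i * w + w * ((1 + w) ^ i - 1) by push_cast; ring]
      refine v.map_le_add ih (le_trans ?_ (le_val_mul hw.ge
        (le_val_one_add_pow_sub_one (by omega) hw.ge i)))
      exact_mod_cast (by omega : b + 1 ≤ b + b)
  have hlin : v (i * w) = b := by rw [v.map_mul, hi, hw, zero_add]
  simpa using val_add_eq hlin hquad

end AddVal

section Ramified

variable {κ : Type*} [Field κ] {L : Type*} [Field L] [Algebra κ⸨X⸩ L]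
  {v : AddValuation L (WithTop ℤ)}

theorem val_smul (c : κ⸨X⸩) (y : L) : v (c • y) = v (algebraMap κ⸨X⸩ L c) + v y := by
  rw [Algebra.smul_def, v.map_mul]

theorem IsFullyRamifiedValuation.val_algebraMap (hv : IsFullyRamifiedValuation κ v) {a : κ⸨X⸩}
    {k : ℤ} (ha : a.orderTop = k) :
    v (algebraMap κ⸨X⸩ L a) = (((Module.finrank κ⸨X⸩ L : ℤ) * k : ℤ) : WithTop ℤ) := by
  rw [hv.ramification, ha, ← WithTop.coe_nsmul, nsmul_eq_mul]

theorem IsFullyRamifiedValuation.exists_val_algebraMap (hv : IsFullyRamifiedValuation κ v)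
    {a : κ⸨X⸩} (ha : a ≠ 0) :
    ∃ k : ℤ, a.orderTop = k ∧
      v (algebraMap κ⸨X⸩ L a) = (((Module.finrank κ⸨X⸩ L : ℤ) * k : ℤ) : WithTop ℤ) := by
  obtain ⟨k, hk⟩ := WithTop.ne_top_iff_exists.1 (HahnSeries.orderTop_ne_top.2 ha)
  exact ⟨k, hk.symm, hv.val_algebraMap hk.symm⟩

theorem IsFullyRamifiedValuation.exists_val_smul (hv : IsFullyRamifiedValuation κ v) {c : κ⸨X⸩}
    (hc : c ≠ 0) {y : L} {e : ℤ} (hy : v y = e) :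
    ∃ k : ℤ, c.orderTop = k ∧
      v (c • y) = (((Module.finrank κ⸨X⸩ L : ℤ) * k + e : ℤ) : WithTop ℤ) := by
  obtain ⟨k, hk, hk'⟩ := hv.exists_val_algebraMap hc
  exact ⟨k, hk, by rw [val_smul, hk', hy, WithTop.coe_add]⟩

theorem IsFullyRamifiedValuation.val_natCast (hv : IsFullyRamifiedValuation κ v) {p : ℕ}
    [CharP κ p] {i : ℕ} (hi : ¬ p ∣ i) : v (i : L) = 0 := by
  have hi0 : (i : κ) ≠ 0 := by rwa [Ne, CharP.cast_eq_zero_iff κ p]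
  have hord : (i : κ⸨X⸩).orderTop = ((0 : ℤ) : WithTop ℤ) := by
    rw [← map_natCast (HahnSeries.C : κ →+* κ⸨X⸩), HahnSeries.C_apply,
      HahnSeries.orderTop_single hi0]
  simpa using hv.val_algebraMap hord

end Ramified

section IncongruentValues

variable {κ : Type*} [Field κ] {L : Type*} [Field L] [Algebra κ⸨X⸩ L]
  {v : AddValuation L (WithTop ℤ)} {ι : Type*} {y : ι → L} {e : ι → ℤ}

/-- A family of elements `y i` of values `e i`, pairwise incongruent modulo the degree. When `v` is
fully ramified the values of scalars are multiples of the degree, so no two terms of a combination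
`∑ c i • y i` can cancel. -/
structure IncongruentValues (κ : Type*) {L : Type*} [Field κ] [Field L] [Algebra κ⸨X⸩ L]
    (v : AddValuation L (WithTop ℤ)) {ι : Type*} (y : ι → L) (e : ι → ℤ) : Prop where
  val_eq : ∀ i, v (y i) = e i
  incongruent : ∀ i j, (Module.finrank κ⸨X⸩ L : ℤ) ∣ e i - e j → i = j

namespace IncongruentValues

variable (hy : IncongruentValues κ v y e) (hv : IsFullyRamifiedValuation κ v)

include hy hv

theorem exists_dominant [Fintype ι] {c : ι → κ⸨X⸩} (hc : c ≠ 0) :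
    ∃ i, c i ≠ 0 ∧ v (∑ j, c j • y j) = v (c i • y i) ∧
      ∀ j, j ≠ i → v (c i • y i) < v (c j • y j) := by
  classical
  obtain ⟨i₀, hi₀⟩ := Function.ne_iff.1 hc
  have : Nonempty ι := ⟨i₀⟩
  obtain ⟨i, hi⟩ := Finite.exists_min fun j => v (c j • y j)
  obtain ⟨k₀, -, hk₀⟩ := hv.exists_val_smul hi₀ (hy.val_eq i₀)
  have hci : c i ≠ 0 := by
    intro h
    have hle := hi i₀
    rw [hk₀, h, zero_smul, v.map_zero, top_le_iff] at hle
    exact WithTop.coe_ne_top hle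
  obtain ⟨k, -, hk⟩ := hv.exists_val_smul hci (hy.val_eq i)
  have hlt : ∀ j, j ≠ i → v (c i • y i) < v (c j • y j) := by
    intro j hj
    refine lt_of_le_of_ne (hi j) fun h => hj ?_
    have hcj : c j ≠ 0 := by
      intro hcj
      rw [hk, hcj, zero_smul, v.map_zero] at h
      exact WithTop.coe_ne_top h
    obtain ⟨l, -, hl⟩ := hv.exists_val_smul hcj (hy.val_eq j)
    rw [hk, hl] at h
    exact hy.incongruent j i ⟨k - l, by linarith [WithTop.coe_injective h]⟩
  refine ⟨i, hci, ?_, hlt⟩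
  rw [← Finset.add_sum_erase _ _ (Finset.mem_univ i), v.map_add_eq_of_lt_left]
  exact v.map_lt_sum (hk ▸ WithTop.coe_ne_top) fun j hj => hlt j (Finset.ne_of_mem_erase hj)

theorem le_val_sum_iff [Fintype ι] (c : ι → κ⸨X⸩) (m : WithTop ℤ) :
    m ≤ v (∑ j, c j • y j) ↔ ∀ j, m ≤ v (c j • y j) := by
  refine ⟨fun h j => ?_, fun h => v.map_le_sum fun j _ => h j⟩
  rcases eq_or_ne c 0 with rfl | hc
  · simp
  obtain ⟨i, -, hval, hlt⟩ := hy.exists_dominant hv hc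
  rw [hval] at h
  rcases eq_or_ne j i with rfl | hj
  · exact h
  · exact h.trans (hlt j hj).le

theorem linearIndependent [Finite ι] : LinearIndependent κ⸨X⸩ y := by
  have := Fintype.ofFinite ι
  rw [Fintype.linearIndependent_iff]
  intro c hc i
  have htop := (hy.le_val_sum_iff hv c ⊤).1 (by simp [hc]) i
  rw [top_le_iff, v.top_iff, smul_eq_zero] at htop
  exact htop.resolve_right (ne_zero_of_val_eq (hy.val_eq i))

variable [Fintype ι]

theorem le_val_apply_sum {f : L →ₗ[κ⸨X⸩] L} {s : ℤ}
    (hf : ∀ i, ((e i + s : ℤ) : WithTop ℤ) ≤ v (f (y i))) {c : ι → κ⸨X⸩} {k : ℤ}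
    (hk : (k : WithTop ℤ) ≤ v (∑ i, c i • y i)) :
    ((k + s : ℤ) : WithTop ℤ) ≤ v (f (∑ i, c i • y i)) := by
  rw [map_sum]
  refine v.map_le_sum fun i _ => ?_
  rw [map_smul]
  rcases eq_or_ne (c i) 0 with hc | hc
  · simp [hc]
  have hki := (hy.le_val_sum_iff hv c k).1 hk i
  obtain ⟨l, hl, hval⟩ := hv.exists_val_smul hc (hy.val_eq i)
  rw [hval] at hki
  rw [Algebra.smul_def]
  refine le_trans ?_ (le_val_mul (hv.val_algebraMap hl).ge (hf i))
  have : k ≤ Module.finrank κ⸨X⸩ L * l + e i := by exact_mod_cast hki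
  exact_mod_cast (by linarith)

variable (hcard : Fintype.card ι = Module.finrank κ⸨X⸩ L)

include hcard

theorem exists_sum_eq [FiniteDimensional κ⸨X⸩ L] (z : L) : ∃ c : ι → κ⸨X⸩, ∑ i, c i • y i = z := by
  have hspan := (hy.linearIndependent hv).span_eq_top_of_card_eq_finrank' hcard
  exact (Submodule.mem_span_range_iff_exists_fun _).1 (hspan ▸ Submodule.mem_top)

variable [FiniteDimensional κ⸨X⸩ L]

theorem exists_lt_val_sub_smul {z : L} {k : ℤ} (hz : v z = k) {i : ι}
    (hi : (Module.finrank κ⸨X⸩ L : ℤ) ∣ k - e i) :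
    ∃ c : κ⸨X⸩, ((k + 1 : ℤ) : WithTop ℤ) ≤ v (z - c • y i) := by
  classical
  obtain ⟨c, rfl⟩ := hy.exists_sum_eq hv hcard z
  have hc : c ≠ 0 := by
    rintro rfl
    simp at hz
  obtain ⟨j, hj, hval, hlt⟩ := hy.exists_dominant hv hc
  obtain ⟨l, -, hl⟩ := hv.exists_val_smul hj (hy.val_eq j)
  rw [← hval, hz] at hlt hl
  have hkl : k = Module.finrank κ⸨X⸩ L * l + e j := WithTop.coe_injective hl
  obtain rfl : j = i := hy.incongruent j i (by
    rw [show e j - e i = k - e i - Module.finrank κ⸨X⸩ L * l by linarith]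
    exact dvd_sub hi (dvd_mul_right _ _))
  refine ⟨c j, ?_⟩
  rw [← Finset.add_sum_erase _ _ (Finset.mem_univ j), add_sub_cancel_left]
  exact v.map_le_sum fun i hi => coe_lt_iff.1 (hlt i (Finset.ne_of_mem_erase hi))

variable {f : L →ₗ[κ⸨X⸩] L} {s : ℤ} (hf : ∀ i, ((e i + s : ℤ) : WithTop ℤ) ≤ v (f (y i)))

include hf

theorem le_val_apply {z : L} {k : ℤ} (hz : (k : WithTop ℤ) ≤ v z) :
    ((k + s : ℤ) : WithTop ℤ) ≤ v (f z) := by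
  obtain ⟨c, rfl⟩ := hy.exists_sum_eq hv hcard z
  exact hy.le_val_apply_sum hv hf hz

theorem val_apply_eq {i : ι} (hi : v (f (y i)) = ((e i + s : ℤ) : WithTop ℤ)) {z : L} {k : ℤ}
    (hz : v z = k) (hk : (Module.finrank κ⸨X⸩ L : ℤ) ∣ k - e i) :
    v (f z) = ((k + s : ℤ) : WithTop ℤ) := by
  obtain ⟨c, hc⟩ := hy.exists_lt_val_sub_smul hv hcard hz hk
  have hcy : v (c • y i) = k := by simpa using val_sub_eq hz hc
  have hc0 : c ≠ 0 := by
    rintro rfl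
    simp at hcy
  obtain ⟨l, hl, hval⟩ := hv.exists_val_smul hc0 (hy.val_eq i)
  have hkl : k = Module.finrank κ⸨X⸩ L * l + e i := WithTop.coe_injective (hcy.symm.trans hval)
  rw [← add_sub_cancel (c • y i) z, map_add, map_smul]
  refine val_add_eq ?_ ?_
  · rw [Algebra.smul_def, val_mul_eq (hv.val_algebraMap hl) hi, hkl, add_assoc]
  · rw [add_right_comm]
    exact hy.le_val_apply hv hcard hf hc

end IncongruentValues

end IncongruentValues

section Uniformizer

variable {κ : Type*} [Field κ] {L : Type*} [Field L] [Algebra κ⸨X⸩ L]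
  {v : AddValuation L (WithTop ℤ)} {π : L}

theorem fin_eq_of_dvd_sub {n : ℕ} {i j : Fin n} (h : (n : ℤ) ∣ (i : ℤ) - (j : ℤ)) : i = j := by
  have := Int.eq_zero_of_abs_lt_dvd h (by rw [abs_lt]; omega)
  omega

theorem val_uniformizer_pow (hπ : v π = 1) (i : ℕ) : v (π ^ i) = ((i : ℤ) : WithTop ℤ) := by
  simpa using val_pow_eq (a := 1) hπ i

theorem incongruentValues_uniformizer_pow (hπ : v π = 1) :
    IncongruentValues κ v (fun i : Fin (Module.finrank κ⸨X⸩ L) => π ^ (i : ℕ)) (fun i => (i : ℕ)) :=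
  ⟨fun i => val_uniformizer_pow hπ i, fun _ _ h => fin_eq_of_dvd_sub h⟩

namespace IsFullyRamifiedValuation

variable [FiniteDimensional κ⸨X⸩ L] (hv : IsFullyRamifiedValuation κ v)

include hv

theorem exists_lt_val_sub_algebraMap {z : L} {k : ℤ} (hz : v z = k)
    (hk : (Module.finrank κ⸨X⸩ L : ℤ) ∣ k) :
    ∃ c : κ⸨X⸩, ((k + 1 : ℤ) : WithTop ℤ) ≤ v (z - algebraMap κ⸨X⸩ L c) := by
  obtain ⟨π, hπ⟩ := hv.normalized 1
  obtain ⟨c, hc⟩ := (incongruentValues_uniformizer_pow hπ).exists_lt_val_sub_smul hv (by simp) hz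
    (i := ⟨0, Module.finrank_pos⟩) (by simpa using hk)
  exact ⟨c, by simpa [Algebra.smul_def] using hc⟩

theorem exists_one_le_val_sub_algebraMap {z : L} (hz : 0 ≤ v z) :
    ∃ c : κ⸨X⸩, 1 ≤ v (z - algebraMap κ⸨X⸩ L c) := by
  rcases hz.eq_or_lt with hz0 | hz1
  · exact hv.exists_lt_val_sub_algebraMap (k := 0) hz0.symm (dvd_zero _)
  · exact ⟨0, by simpa using (coe_lt_iff (k := 0)).1 hz1⟩

/- `π` satisfies an Eisenstein equation over `κ⸨X⸩`, and so does `σ π`. -/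
theorem one_le_val_algEquiv (hπ : v π = 1) (σ : L ≃ₐ[κ⸨X⸩] L) : 1 ≤ v (σ π) := by
  have hy := incongruentValues_uniformizer_pow (κ := κ) hπ
  obtain ⟨c, hc⟩ := hy.exists_sum_eq hv (by simp) (π ^ Module.finrank κ⸨X⸩ L)
  have hval := (hy.le_val_sum_iff hv c _).1 (by rw [hc, val_uniformizer_pow hπ])
  refine one_le_val_of_pow_eq_sum (a := fun i => algebraMap κ⸨X⸩ L (c i)) (fun i => ?_) ?_
  · rcases eq_or_ne (c i) 0 with h | h
    · simp [h]
    obtain ⟨l, hl, hval'⟩ := hv.exists_val_smul h (hy.val_eq i)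
    have hle := (hval i).trans_eq hval'
    rw [hv.val_algebraMap hl]
    have hi : ((i : ℕ) : ℤ) < Module.finrank κ⸨X⸩ L := by exact_mod_cast i.2
    have hpos : (0 : ℤ) < Module.finrank κ⸨X⸩ L * l := by
      have : (Module.finrank κ⸨X⸩ L : ℤ) ≤ Module.finrank κ⸨X⸩ L * l + (i : ℕ) := by
        exact_mod_cast hle
      linarith
    exact_mod_cast hpos
  · simpa [Algebra.smul_def] using (congrArg σ hc).symm

theorem le_val_algEquiv (σ : L ≃ₐ[κ⸨X⸩] L) (z : L) : v z ≤ v (σ z) := by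
  rcases eq_or_ne z 0 with rfl | hz
  · simp
  obtain ⟨π, hπ⟩ := hv.normalized 1
  obtain ⟨k, hk⟩ := exists_val_eq (v := v) hz
  rw [hk]
  have := (incongruentValues_uniformizer_pow (κ := κ) hπ).le_val_apply hv (by simp)
    (f := σ.toLinearMap) (s := 0)
    (fun i => by simpa using le_val_pow (a := 1) (hv.one_le_val_algEquiv hπ σ) i) hk.ge
  simpa using this

theorem val_algEquiv (σ : L ≃ₐ[κ⸨X⸩] L) (z : L) : v (σ z) = v z :=
  le_antisymm (by simpa using hv.le_val_algEquiv σ.symm (σ z)) (hv.le_val_algEquiv σ z)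

end IsFullyRamifiedValuation

end Uniformizer

section Ramification

theorem action_Psi₂_apply {K L : Type*} [Field K] [Field L] [Algebra K L] (σ : L ≃ₐ[K] L) (z : L) :
    action (Psi₂ σ) z = σ z - z := by
  simp [Psi₂, action_grp]

variable {κ : Type*} [Field κ] {L : Type*} [Field L] [Algebra κ⸨X⸩ L]
  {v : AddValuation L (WithTop ℤ)} {π : L} {σ : L ≃ₐ[κ⸨X⸩] L} {b : ℤ}

theorem exists_sub_uniformizer_pow_eq (hπ : v π = 1)
    (hb : v (σ π - π) = ((b + 1 : ℤ) : WithTop ℤ)) :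
    ∃ w : L, v w = b ∧ ∀ i : ℕ, σ (π ^ i) - π ^ i = π ^ i * ((1 + w) ^ i - 1) := by
  have hπ0 : π ≠ 0 := ne_zero_of_val_eq (k := 1) hπ
  have hw0 : (σ π - π) / π ≠ 0 := div_ne_zero (ne_zero_of_val_eq hb) hπ0
  refine ⟨(σ π - π) / π, ?_, fun i => ?_⟩
  · obtain ⟨k, hk⟩ := exists_val_eq (v := v) hw0
    have hmul := val_mul_eq hk (b := 1) hπ
    rw [div_mul_cancel₀ _ hπ0, hb] at hmul
    rw [hk]
    exact congrArg _ (add_right_cancel (WithTop.coe_injective hmul)).symm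
  · rw [map_pow, mul_sub, ← mul_pow, mul_add, mul_div_cancel₀ _ hπ0, mul_one, mul_one,
      add_sub_cancel]

theorem le_val_Psi₂_uniformizer_pow (hπ : v π = 1)
    (hb : v (σ π - π) = ((b + 1 : ℤ) : WithTop ℤ)) (hb0 : 0 ≤ b) (i : ℕ) :
    ((i + b : ℤ) : WithTop ℤ) ≤ v (action (Psi₂ σ) (π ^ i)) := by
  obtain ⟨w, hw, h⟩ := exists_sub_uniformizer_pow_eq hπ hb
  rw [action_Psi₂_apply, h i]
  exact le_val_mul (val_uniformizer_pow hπ i).ge (le_val_one_add_pow_sub_one hb0 hw.ge i)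

namespace IsFullyRamifiedValuation

theorem le_val_pow_sub [FiniteDimensional κ⸨X⸩ L] (hv : IsFullyRamifiedValuation κ v)
    (σ : L ≃ₐ[κ⸨X⸩] L) (z : L) (k : ℕ) : v (σ z - z) ≤ v ((σ ^ k) z - z) := by
  induction k with
  | zero => simp
  | succ k ih =>
    rw [show (σ ^ (k + 1)) z - z = (σ ^ k) (σ z - z) + ((σ ^ k) z - z) by
      rw [pow_succ, AlgEquiv.mul_apply, map_sub]
      ring]
    exact v.map_le_add (hv.val_algEquiv _ _).ge ih

theorem val_pow_sub_eq_of_coprime [FiniteDimensional κ⸨X⸩ L]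
    (hv : IsFullyRamifiedValuation κ v) (z : L) {k : ℕ} (hk : k.Coprime (orderOf σ)) :
    v ((σ ^ k) z - z) = v (σ z - z) := by
  obtain ⟨m, hm⟩ := exists_pow_eq_self_of_coprime hk
  refine le_antisymm ?_ (hv.le_val_pow_sub σ z k)
  simpa [hm] using hv.le_val_pow_sub (σ ^ k) z m

variable (hv : IsFullyRamifiedValuation κ v) (hπ : v π = 1)
  (hb : v (σ π - π) = ((b + 1 : ℤ) : WithTop ℤ))

include hv hπ hb

theorem val_Psi₂_uniformizer_pow {p : ℕ} [CharP κ p] (hb1 : 1 ≤ b) {i : ℕ} (hi : ¬ p ∣ i) :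
    v (action (Psi₂ σ) (π ^ i)) = ((i + b : ℤ) : WithTop ℤ) := by
  obtain ⟨w, hw, h⟩ := exists_sub_uniformizer_pow_eq hπ hb
  rw [action_Psi₂_apply, h i]
  exact val_mul_eq (val_uniformizer_pow hπ i) (val_one_add_pow_sub_one hb1 hw (hv.val_natCast hi))

variable [FiniteDimensional κ⸨X⸩ L]

theorem val_Psi₂ {p : ℕ} [CharP κ p] (hp : p ∣ Module.finrank κ⸨X⸩ L) (hb1 : 1 ≤ b) {z : L}
    {k : ℤ} (hz : v z = k) (hk : ¬ (p : ℤ) ∣ k) :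
    v (action (Psi₂ σ) z) = ((k + b : ℤ) : WithTop ℤ) := by
  have hn : (0 : ℤ) < Module.finrank κ⸨X⸩ L := by exact_mod_cast Module.finrank_pos
  obtain ⟨i, hi⟩ := Int.eq_ofNat_of_zero_le (Int.emod_nonneg k hn.ne')
  have hlt : i < Module.finrank κ⸨X⸩ L := by exact_mod_cast hi ▸ Int.emod_lt_of_pos k hn
  have hdvd : (Module.finrank κ⸨X⸩ L : ℤ) ∣ k - i := by
    rw [← hi]
    exact Int.dvd_self_sub_emod
  have hpi : ¬ p ∣ i := fun h => hk <| by
    rw [← sub_add_cancel k i]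
    exact dvd_add ((Int.natCast_dvd_natCast.2 hp).trans hdvd) (Int.natCast_dvd_natCast.2 h)
  exact (incongruentValues_uniformizer_pow hπ).val_apply_eq hv (by simp)
    (fun i => le_val_Psi₂_uniformizer_pow hπ hb (by omega) i) (i := ⟨i, hlt⟩)
    (hv.val_Psi₂_uniformizer_pow hπ hb hb1 hpi) hz hdvd

end IsFullyRamifiedValuation

end Ramification

section Binom

variable {F : Type*} [Field F]

@[simp]
theorem binom_zero (y : F) : binom y 0 = 1 := by simp [binom]

theorem map_binom {F' : Type*} [Field F'] (f : F →+* F') (y : F) (i : ℕ) :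
    f (binom y i) = binom (f y) i := by
  simp [binom, map_prod]

theorem factorial_ne_zero_of_lt (p : ℕ) [hp : Fact p.Prime] [CharP F p] {i : ℕ} (h : i < p) :
    (i.factorial : F) ≠ 0 := by
  rw [Ne, CharP.cast_eq_zero_iff F p, hp.out.dvd_factorial]
  omega

theorem binom_eq_smeval_descPochhammer (y : F) (i : ℕ) :
    binom y i = (descPochhammer ℤ i).smeval y / i.factorial := by
  rw [binom]
  congr 1
  induction i with
  | zero => simp
  | succ i ih =>
    rw [Finset.prod_range_succ, ih, descPochhammer_succ_right, Polynomial.smeval_mul,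
      Polynomial.smeval_sub, Polynomial.smeval_X, Polynomial.smeval_natCast, pow_zero, pow_one,
      nsmul_one]

theorem binom_add (p : ℕ) [Fact p.Prime] [CharP F p] (x y : F) {i : ℕ} (hi : i < p) :
    binom (x + y) i =
      ∑ ij ∈ Finset.HasAntidiagonal.antidiagonal i, binom x ij.1 * binom y ij.2 := by
  simp only [binom_eq_smeval_descPochhammer]
  rw [Ring.descPochhammer_smeval_add i (Commute.all x y), Finset.sum_div]
  refine Finset.sum_congr rfl fun ij hij => ?_
  have hle := Finset.HasAntidiagonal.antidiagonal.fst_le hij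
  have hle' := Finset.HasAntidiagonal.antidiagonal.snd_le hij
  have h1 := factorial_ne_zero_of_lt (F := F) p (hle.trans_lt hi)
  have h2 := factorial_ne_zero_of_lt (F := F) p (hle'.trans_lt hi)
  have hchoose : (i.choose ij.1 : F) * (ij.1.factorial * ij.2.factorial) = i.factorial := by
    rw [← Nat.choose_mul_factorial_mul_factorial hle,
      Nat.sub_eq_of_eq_add' (Finset.HasAntidiagonal.mem_antidiagonal.1 hij).symm]
    push_cast
    ring
  rw [div_mul_div_comm, div_eq_div_iff (factorial_ne_zero_of_lt p hi) (mul_ne_zero h1 h2),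
    ← hchoose]
  ring

theorem binom_one (y : F) : binom y 1 = y := by simp [binom]

theorem binom_add_one (p : ℕ) [Fact p.Prime] [CharP F p] (y : F) {i : ℕ} (hi : i + 1 < p) :
    binom (y + 1) (i + 1) = binom y (i + 1) + binom y i := by
  have hone : ∀ j, binom (1 : F) (j + 2) = 0 := fun j => by
    rw [binom, Finset.prod_eq_zero (i := 1) (by simp) (by simp), zero_div]
  rw [add_comm y, binom_add p _ _ hi, Finset.Nat.sum_antidiagonal_eq_sum_range_succ_mk,
    Finset.sum_range_succ', Finset.sum_range_succ']
  simp [hone, binom_one, add_comm (binom y i)]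

end Binom

section Witt

theorem map_wittPoly {R S : Type*} [CommRing R] [CommRing S] (f : R →+* S) (p : ℕ) (x y : R) :
    f (wittPoly p x y) = wittPoly p (f x) (f y) := by
  simp [wittPoly, map_sum]

theorem mul_wittPoly {R : Type*} [CommRing R] {p : ℕ} (hp : p.Prime) (x y : R) :
    (p : R) * wittPoly p x y = x ^ p + y ^ p - (x + y) ^ p := by
  have hterm : ∀ i ∈ Finset.Ico 1 p, (p : R) * (((p.choose i / p : ℕ) : R) * x ^ i * y ^ (p - i)) =
      x ^ i * y ^ (p - i) * (p.choose i : R) := by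
    intro i hi
    rw [Finset.mem_Ico] at hi
    rw [← Nat.mul_div_cancel' (hp.dvd_choose_self (by omega) hi.2), Nat.cast_mul,
      Nat.mul_div_cancel_left _ hp.pos]
    ring
  rw [wittPoly, mul_neg, Finset.mul_sum, Finset.sum_congr rfl hterm, add_pow,
    Finset.sum_range_succ, Finset.range_eq_Ico, Finset.sum_eq_sum_Ico_succ_bot hp.pos]
  simp
  ring

open Polynomial in
theorem exists_sum_wittPoly_X_add_one {p : ℕ} (hp : p.Prime) :
    ∃ Q : ℤ[X], ∑ i ∈ Finset.range p, wittPoly p ((X : ℤ[X]) + (i : ℤ[X])) 1 =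
      1 - (p : ℤ[X]) * Q := by
  obtain ⟨Q, hQ⟩ := dvd_sub_pow_of_dvd_sub (p := p) (a := (X : ℤ[X]) + (p : ℤ[X])) (b := X)
    (by simp) 1
  refine ⟨Q, mul_left_cancel₀ (Nat.cast_ne_zero.2 hp.ne_zero : (p : ℤ[X]) ≠ 0) ?_⟩
  have htele : ∀ i : ℕ, (p : ℤ[X]) * wittPoly p (X + (i : ℤ[X])) 1 =
      1 - ((X + ((i + 1 : ℕ) : ℤ[X])) ^ p - (X + (i : ℤ[X])) ^ p) := by
    intro i
    rw [mul_wittPoly hp]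
    push_cast
    ring
  rw [Finset.mul_sum, Finset.sum_congr rfl fun i _ => htele i, Finset.sum_sub_distrib,
    Finset.sum_range_sub fun i : ℕ => (X + (i : ℤ[X])) ^ p]
  simp only [pow_one, Nat.cast_zero, add_zero] at hQ ⊢
  rw [hQ]
  simp
  ring

/- In the Witt vectors this is the identity `p • (1, 0) = (0, 1)`. -/
theorem sum_wittPoly_add_one {R : Type*} [CommRing R] {p : ℕ} [hp : Fact p.Prime] [CharP R p]
    (x : R) : ∑ i ∈ Finset.range p, wittPoly p (x + i) 1 = 1 := by
  obtain ⟨Q, hQ⟩ := exists_sum_wittPoly_X_add_one hp.out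
  simpa [map_wittPoly] using congrArg (Polynomial.eval₂RingHom (Int.castRingHom R) x) hQ

theorem le_val_wittPoly {L : Type*} [Field L] {v : AddValuation L (WithTop ℤ)} {p : ℕ} {x y : L}
    {a c k : ℤ} (hx : (a : WithTop ℤ) ≤ v x) (hy : (c : WithTop ℤ) ≤ v y)
    (h : ∀ i : ℤ, 1 ≤ i → i + 1 ≤ p → k ≤ i * a + (p - i) * c) :
    (k : WithTop ℤ) ≤ v (wittPoly p x y) := by
  rw [wittPoly, v.map_neg]
  refine v.map_le_sum fun i hi => ?_
  rw [Finset.mem_Ico] at hi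
  have hterm := le_val_mul (le_val_mul (a := 0) (val_natCast_nonneg (p.choose i / p))
    (le_val_pow hx i)) (le_val_pow hy (p - i))
  refine le_trans ?_ hterm
  rw [Nat.cast_sub hi.2.le, zero_add]
  exact_mod_cast h i (by omega) (by omega)

end Witt

section Automorphisms

variable {K L : Type*} [Field K] [Field L] [Algebra K L] {σ : L ≃ₐ[K] L} {x y : L}

theorem pow_apply_eq_add_natCast (hx : σ x - x = 1) (k : ℕ) : (σ ^ k) x = x + k := by
  induction k with
  | zero => simp
  | succ k ih =>
    rw [pow_succ', AlgEquiv.mul_apply, ih, map_add, map_natCast, sub_eq_iff_eq_add.1 hx]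
    push_cast
    ring

theorem pow_apply_eq_add_sum_wittPoly {p : ℕ} (hx : σ x - x = 1)
    (hy : σ y - y = wittPoly p x 1) (k : ℕ) :
    (σ ^ k) y = y + ∑ i ∈ Finset.range k, wittPoly p (x + i) 1 := by
  induction k with
  | zero => simp
  | succ k ih =>
    have h : (σ ^ k) (wittPoly p x 1) = wittPoly p (x + k) 1 := by
      simpa [pow_apply_eq_add_natCast hx] using
        map_wittPoly ((σ ^ k : L ≃ₐ[K] L) : L →+* L) p x 1
    rw [pow_succ, AlgEquiv.mul_apply, sub_eq_iff_eq_add.1 hy, map_add, ih, h,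
      Finset.sum_range_succ]
    ring

theorem Psi₂_pow_prime {p : ℕ} [Fact p.Prime] [CharP K p] (σ : L ≃ₐ[K] L) :
    Psi₂ σ ^ p = Psi₂ (σ ^ p) := by
  have : CharP (MonoidAlgebra K (L ≃ₐ[K] L)) p := charP_of_injective_algebraMap
    (FaithfulSMul.algebraMap_injective K (MonoidAlgebra K (L ≃ₐ[K] L))) p
  rw [Psi₂, Psi₂, sub_pow_expChar_of_commute p (Commute.one_right _), one_pow, grp, grp, map_pow]

variable {p : ℕ} [CharP L p]

theorem pow_prime_apply_eq_self (hx : σ x - x = 1) : (σ ^ p) x = x := by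
  rw [pow_apply_eq_add_natCast hx, CharP.cast_eq_zero, add_zero]

variable [Fact p.Prime]

theorem pow_prime_apply_eq_add_one (hx : σ x - x = 1) (hy : σ y - y = wittPoly p x 1) :
    (σ ^ p) y = y + 1 := by
  rw [pow_apply_eq_add_sum_wittPoly hx hy, sum_wittPoly_add_one]

theorem Psi₂_binom_succ (hx : σ x - x = 1) {j : ℕ} (hj : j + 1 < p) :
    action (Psi₂ σ) (binom x (j + 1)) = binom x j := by
  have h := map_binom ((σ : L ≃ₐ[K] L) : L →+* L) x (j + 1)
  rw [RingHom.coe_coe, sub_eq_iff_eq_add'.1 hx, binom_add_one p x hj] at h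
  rw [action_Psi₂_apply, h, add_sub_cancel_left]

theorem Psi₂_pow_binom (hx : σ x - x = 1) (k : ℕ) {j : ℕ} (hj : k + j < p) :
    action (Psi₂ σ ^ k) (binom x (k + j)) = binom x j := by
  induction k with
  | zero => simp
  | succ k ih =>
    rw [pow_succ, map_mul, Module.End.mul_apply, add_right_comm,
      Psi₂_binom_succ hx (by omega), ih (by omega)]

theorem exists_sum_binom_of_Psi₂_pow_eq_zero [FiniteDimensional K L] [IsGalois K L]
    (hσ : ∀ τ : L ≃ₐ[K] L, τ ∈ Subgroup.zpowers σ) (hx : σ x - x = 1) {m : ℕ} (hm : m ≤ p)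
    {z : L} (hz : action (Psi₂ σ ^ m) z = 0) :
    ∃ c : ℕ → K, z = ∑ j ∈ Finset.range m, c j • binom x j := by
  induction m generalizing z with
  | zero => exact ⟨0, by simpa using hz⟩
  | succ m ih =>
    have hfix : σ ∈ MulAction.stabilizer (L ≃ₐ[K] L) (action (Psi₂ σ ^ m) z) := by
      rw [pow_succ', map_mul, Module.End.mul_apply, action_Psi₂_apply] at hz
      exact sub_eq_zero.1 hz
    obtain ⟨a, ha⟩ : action (Psi₂ σ ^ m) z ∈ Set.range (algebraMap K L) := by
      rw [IsGalois.mem_range_algebraMap_iff_fixed]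
      exact fun τ => (Subgroup.zpowers_le.2 hfix) (hσ τ)
    have hm' : action (Psi₂ σ ^ m) (binom x m) = 1 := by
      simpa using Psi₂_pow_binom hx m (j := 0) (by omega)
    obtain ⟨c, hc⟩ := ih (by omega) (z := z - a • binom x m) (by
      rw [map_sub, map_smul, ← ha, hm', Algebra.algebraMap_eq_smul_one, sub_self])
    refine ⟨Function.update c m a, ?_⟩
    rw [Finset.sum_range_succ, Function.update_self, ← sub_eq_iff_eq_add, hc]
    refine Finset.sum_congr rfl fun j hj => ?_
    rw [Function.update_of_ne (Finset.mem_range.1 hj).ne]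

theorem exists_sum_binom_eq_of_pow_prime_fixed [FiniteDimensional K L] [IsGalois K L] [CharP K p]
    (hσ : ∀ τ : L ≃ₐ[K] L, τ ∈ Subgroup.zpowers σ) (hx : σ x - x = 1) {z : L}
    (hz : (σ ^ p) z = z) : ∃ c : Fin p → K, ∑ i, c i • binom x i = z := by
  obtain ⟨c, hc⟩ := exists_sum_binom_of_Psi₂_pow_eq_zero hσ hx le_rfl (z := z)
    (by rw [Psi₂_pow_prime, action_Psi₂_apply, hz, sub_self])
  exact ⟨fun i => c i, by rw [hc, Finset.sum_range]⟩

end Automorphisms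

section ArtinSchreier

variable {L : Type*} [Field L] {v : AddValuation L (WithTop ℤ)} {x : L} {n : ℕ}

theorem val_pow_sub_self (hn : 1 < n) {l : ℤ} (hl : l < 0) (hx : v x = l) :
    v (x ^ n - x) = ((n * l : ℤ) : WithTop ℤ) := by
  refine val_sub_eq (val_pow_eq hx n) ?_
  rw [hx]
  have : (n * l + 1 : ℤ) ≤ l := by
    have : (1 : ℤ) < n := by exact_mod_cast hn
    nlinarith
  exact_mod_cast this

theorem val_eq_of_val_pow_sub (hn : 1 < n) {k : ℤ} (hk : k < 0)
    (h : v (x ^ n - x) = ((n * k : ℤ) : WithTop ℤ)) : v x = k := by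
  have hn0 : (0 : ℤ) < n := by omega
  have hx0 : x ≠ 0 := by
    rintro rfl
    exact ne_zero_of_val_eq h (by simp [show n ≠ 0 by omega])
  obtain ⟨l, hl⟩ := exists_val_eq (v := v) hx0
  have hl0 : l < 0 := by
    by_contra! hl0
    have hx1 : ((0 : ℤ) : WithTop ℤ) ≤ v x := by rw [hl]; exact_mod_cast hl0
    have h0 : ((0 : ℤ) : WithTop ℤ) ≤ v (x ^ n - x) :=
      v.map_le_sub (by simpa using le_val_pow hx1 n) hx1
    rw [h] at h0
    have : (0 : ℤ) ≤ n * k := by exact_mod_cast h0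
    nlinarith
  rw [val_pow_sub_self hn hl0 hl] at h
  rw [hl, mul_left_cancel₀ hn0.ne' (WithTop.coe_injective h)]

end ArtinSchreier

section Arithmetic

variable {p : ℕ} [hp : Fact p.Prime] {κ : Type*} [Field κ] [CharP κ p]
  {L : Type*} [Field L] [Algebra κ⸨X⸩ L] {v : AddValuation L (WithTop ℤ)} {x : L}

theorem charP_of_algebra_laurentSeries (p : ℕ) (κ : Type*) [Field κ] [CharP κ p]
    (L : Type*) [Field L] [Algebra κ⸨X⸩ L] : CharP L p :=
  charP_of_injective_ringHom
    ((algebraMap κ⸨X⸩ L).comp (HahnSeries.C : κ →+* κ⸨X⸩)).injective p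

namespace IsFullyRamifiedValuation

section Binom

variable (hv : IsFullyRamifiedValuation κ v) {a : ℤ} {i : ℕ} (hi : i < p)

include hp hv hi

theorem val_binom_eq_val_prod (x : L) :
    v (binom x i) = v (∏ k ∈ Finset.range i, (x - k)) := by
  have : CharP L p := charP_of_algebra_laurentSeries p κ L
  have hfac : v (i.factorial : L) = 0 :=
    hv.val_natCast (p := p) (by rw [hp.out.dvd_factorial]; omega)
  rw [← div_mul_cancel₀ (∏ k ∈ Finset.range i, (x - k)) (factorial_ne_zero_of_lt p hi), v.map_mul,
    hfac, add_zero, binom]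

theorem val_binom (ha : 0 < a) (hx : v x = ((-a : ℤ) : WithTop ℤ)) :
    v (binom x i) = ((-(i * a) : ℤ) : WithTop ℤ) := by
  rw [hv.val_binom_eq_val_prod hi,
    val_prod_eq (a := fun _ => -a) fun k _ => val_sub_eq hx ?_]
  · simp
  · refine le_trans ?_ (val_natCast_nonneg k)
    exact_mod_cast (by omega : -a + 1 ≤ 0)

theorem le_val_binom (ha : 0 ≤ a) (hx : ((-a : ℤ) : WithTop ℤ) ≤ v x) :
    ((-(i * a) : ℤ) : WithTop ℤ) ≤ v (binom x i) := by
  rw [hv.val_binom_eq_val_prod hi]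
  have hprod := le_val_prod (v := v) (s := Finset.range i) (f := fun k : ℕ => x - (k : L))
    (a := fun _ => -a) fun k _ => v.map_le_sub hx (le_trans ?_ (val_natCast_nonneg k))
  · simpa using hprod
  · exact_mod_cast (by omega : -a ≤ 0)

end Binom

theorem incongruentValues_binom (hv : IsFullyRamifiedValuation κ v)
    (hdeg : Module.finrank κ⸨X⸩ L = p ^ 2) {u : ℤ} (hu : 0 < u) (hpu : ¬ (p : ℤ) ∣ u)
    (hx : v x = ((-(p * u) : ℤ) : WithTop ℤ)) :
    IncongruentValues κ v (fun i : Fin p => binom x i) (fun i => -(i * (p * u))) := by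
  have hp0 : (0 : ℤ) < p := by exact_mod_cast hp.out.pos
  refine ⟨fun i => hv.val_binom i.2 (mul_pos hp0 hu) hx, fun i j hij => fin_eq_of_dvd_sub ?_⟩
  rw [hdeg, show -((i : ℕ) * (p * u)) - -((j : ℕ) * (p * u)) = p * (u * ((j : ℕ) - (i : ℕ)) : ℤ) by
    ring, Nat.cast_pow, pow_two, mul_dvd_mul_iff_left hp0.ne'] at hij
  rw [← dvd_neg, neg_sub]
  exact ((Nat.prime_iff_prime_int.1 hp.out).dvd_or_dvd hij).resolve_left hpu

theorem val_algebraMap_mono (hv : IsFullyRamifiedValuation κ v) {a b : κ⸨X⸩}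
    (h : a.orderTop ≤ b.orderTop) : v (algebraMap κ⸨X⸩ L a) ≤ v (algebraMap κ⸨X⸩ L b) := by
  rw [hv.ramification, hv.ramification]
  exact nsmul_le_nsmul_right h _

variable [FiniteDimensional κ⸨X⸩ L] {σ : L ≃ₐ[κ⸨X⸩] L} {u : ℤ}

theorem val_neg_of_sub_eq_one (hv : IsFullyRamifiedValuation κ v) (hσx : σ x - x = 1) :
    v x < 0 := by
  by_contra! h
  obtain ⟨c, hc⟩ := hv.exists_one_le_val_sub_algebraMap h
  have hone : σ (x - algebraMap κ⸨X⸩ L c) - (x - algebraMap κ⸨X⸩ L c) = 1 := by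
    rw [map_sub, AlgEquiv.commutes, sub_sub_sub_cancel_right, hσx]
  have hle := v.map_le_sub ((hv.val_algEquiv σ _).symm ▸ hc) hc
  rw [hone, v.map_one] at hle
  exact absurd hle (by norm_num)

theorem exists_val_artinSchreier (hv : IsFullyRamifiedValuation κ v)
    (hdeg : Module.finrank κ⸨X⸩ L = p ^ 2) (hx0 : v x < 0) {β : κ⸨X⸩}
    (hβ : ∀ c : κ⸨X⸩, (β + (c ^ p - c)).orderTop ≤ β.orderTop)
    (hx : x ^ p - x = algebraMap κ⸨X⸩ L β) :
    ∃ u : ℤ, 0 < u ∧ ¬ (p : ℤ) ∣ u ∧ β.orderTop = ((-u : ℤ) : WithTop ℤ) ∧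
      v x = ((-(p * u) : ℤ) : WithTop ℤ) := by
  have : CharP L p := charP_of_algebra_laurentSeries p κ L
  have hp1 : (1 : ℤ) < p := by exact_mod_cast hp.out.one_lt
  obtain ⟨l, hl⟩ := WithTop.ne_top_iff_exists.1 hx0.ne_top
  have hl0 : l < 0 := by
    rw [← hl] at hx0
    exact_mod_cast hx0
  have hβl : v (algebraMap κ⸨X⸩ L β) = ((p * l : ℤ) : WithTop ℤ) :=
    hx ▸ val_pow_sub_self hp.out.one_lt hl0 hl.symm
  have hβ0 : β ≠ 0 := by
    rintro rfl
    exact ne_zero_of_val_eq hβl (map_zero _)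
  obtain ⟨k, hk, hk'⟩ := hv.exists_val_algebraMap hβ0
  have hlk : l = p * k := by
    have : (p * l : ℤ) = (p ^ 2 : ℕ) * k := WithTop.coe_injective (by rw [← hβl, hk', hdeg])
    push_cast at this
    exact mul_left_cancel₀ (by omega : (p : ℤ) ≠ 0) (by linarith)
  refine ⟨-k, by nlinarith, fun hpk => ?_, by simpa using hk, by rw [← hl, hlk]; simp⟩
  -- if `p ∣ k`, the leading term of `x` is that of a scalar `c`, and replacing `x` by `x - c`
  -- improves `β`
  obtain ⟨c, hc⟩ := hv.exists_lt_val_sub_algebraMap hl.symm (by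
    rw [hdeg, hlk, Nat.cast_pow, pow_two]
    exact mul_dvd_mul_left _ ((dvd_neg).1 hpk))
  have himp : (x - algebraMap κ⸨X⸩ L c) ^ p - (x - algebraMap κ⸨X⸩ L c) =
      algebraMap κ⸨X⸩ L (β + ((-c) ^ p - -c)) := by
    rw [sub_eq_add_neg x, ← map_neg, add_pow_char, map_add, ← hx, map_sub, map_pow]
    ring
  have hlt : ((p * l + 1 : ℤ) : WithTop ℤ) ≤ v (algebraMap κ⸨X⸩ L (β + ((-c) ^ p - -c))) := by
    rw [← himp]
    refine v.map_le_sub (le_trans ?_ (le_val_pow hc p)) (le_trans ?_ hc)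
    · exact_mod_cast (by nlinarith : p * l + 1 ≤ p * (l + 1))
    · exact_mod_cast (by nlinarith : p * l + 1 ≤ l + 1)
  have := hlt.trans ((hv.val_algebraMap_mono (hβ (-c))).trans_eq hβl)
  exact absurd (WithTop.coe_le_coe.1 this) (by omega)

end IsFullyRamifiedValuation

section RamificationNumber

open Polynomial in
theorem coeff_prod_X_sub_C_mem {R : Type*} [CommRing R] {S : Subring R} {ι : Type*} {s : Finset ι}
    {a : ι → R} (ha : ∀ i ∈ s, a i ∈ S) (k : ℕ) : (∏ i ∈ s, (X - C (a i))).coeff k ∈ S := by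
  have hlift : ∏ i ∈ s, (X - C (a i)) ∈ liftsRing S.subtype :=
    prod_mem fun i hi => sub_mem ((lifts_iff_liftsRing _ _).1 (X_mem_lifts _))
      ((lifts_iff_liftsRing _ _).1 (C_mem_lifts S.subtype ⟨a i, ha i hi⟩))
  obtain ⟨c, hc⟩ := (lifts_iff_coeff_lifts _).1 ((lifts_iff_liftsRing _ _).2 hlift) k
  exact hc ▸ c.2

namespace IsFullyRamifiedValuation

variable [IsGalois κ⸨X⸩ L] {σ : L ≃ₐ[κ⸨X⸩] L} {u : ℤ} (hv : IsFullyRamifiedValuation κ v)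
  (hdeg : Module.finrank κ⸨X⸩ L = p ^ 2) (hσ : ∀ τ : L ≃ₐ[κ⸨X⸩] L, τ ∈ Subgroup.zpowers σ)
  (hσx : σ x - x = 1) (hu : 0 < u) (hpu : ¬ (p : ℤ) ∣ u)
  (hx : v x = ((-(p * u) : ℤ) : WithTop ℤ))

include hv hdeg hσ hσx hu hpu hx

theorem dvd_val_of_fixed [FiniteDimensional κ⸨X⸩ L] {z : L} (hz : (σ ^ p) z = z) {k : ℤ}
    (hk : v z = k) : (p : ℤ) ∣ k := by
  have : CharP L p := charP_of_algebra_laurentSeries p κ L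
  have : CharP κ⸨X⸩ p := charP_of_algebra_laurentSeries p κ _
  have hy := hv.incongruentValues_binom hdeg hu hpu hx
  obtain ⟨c, rfl⟩ := exists_sum_binom_eq_of_pow_prime_fixed hσ hσx hz
  have hc : c ≠ 0 := by
    rintro rfl
    exact ne_zero_of_val_eq hk (by simp)
  obtain ⟨i, hi, hval, -⟩ := hy.exists_dominant hv hc
  obtain ⟨l, -, hl⟩ := hv.exists_val_smul hi (hy.val_eq i)
  rw [hval, hl, hdeg] at hk
  rw [← WithTop.coe_injective hk]
  exact ⟨p * l - i * u, by push_cast; ring⟩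

theorem exists_le_val_sub_algebraMap_of_fixed [FiniteDimensional κ⸨X⸩ L] {z : L}
    (hz : (σ ^ p) z = z) (hz0 : 0 ≤ v z) :
    ∃ c : κ⸨X⸩, ((p : ℤ) : WithTop ℤ) ≤ v (z - algebraMap κ⸨X⸩ L c) := by
  obtain ⟨c, hc⟩ := hv.exists_one_le_val_sub_algebraMap hz0
  refine ⟨c, ?_⟩
  rcases eq_or_ne (z - algebraMap κ⸨X⸩ L c) 0 with h0 | h0
  · simp [h0]
  obtain ⟨k, hk⟩ := exists_val_eq (v := v) h0
  have hfix : (σ ^ p) (z - algebraMap κ⸨X⸩ L c) = z - algebraMap κ⸨X⸩ L c := by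
    rw [map_sub, hz, AlgEquiv.commutes]
  have hdvd := hv.dvd_val_of_fixed hdeg hσ hσx hu hpu hx hfix hk
  rw [hk] at hc ⊢
  exact_mod_cast Int.le_of_dvd (by exact_mod_cast hc) hdvd

theorem le_val_sub_of_fixed [FiniteDimensional κ⸨X⸩ L] {z : L} (hz : (σ ^ p) z = z)
    (hz0 : 0 ≤ v z) : ((p * (u + 1) : ℤ) : WithTop ℤ) ≤ v (σ z - z) := by
  have : CharP L p := charP_of_algebra_laurentSeries p κ L
  have : CharP κ⸨X⸩ p := charP_of_algebra_laurentSeries p κ _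
  have hpu0 : 0 < p * u := mul_pos (by exact_mod_cast hp.out.pos) hu
  have hy := hv.incongruentValues_binom hdeg hu hpu hx
  have hshift : ∀ i : Fin p, ((-(i * (p * u)) + p * u : ℤ) : WithTop ℤ) ≤
      v (action (Psi₂ σ) (binom x i)) := by
    rintro ⟨_ | i, hi⟩
    · simp [action_Psi₂_apply]
    · rw [Psi₂_binom_succ hσx hi, hv.val_binom (by omega) hpu0 hx]
      exact_mod_cast (by push_cast; linarith : -((i + 1 : ℕ) * (p * u)) + p * u ≤ -(i * (p * u)))
  obtain ⟨c, hc⟩ := hv.exists_le_val_sub_algebraMap_of_fixed hdeg hσ hσx hu hpu hx hz hz0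
  have hfix : (σ ^ p) (z - algebraMap κ⸨X⸩ L c) = z - algebraMap κ⸨X⸩ L c := by
    rw [map_sub, hz, AlgEquiv.commutes]
  have hsub : σ (z - algebraMap κ⸨X⸩ L c) - (z - algebraMap κ⸨X⸩ L c) = σ z - z := by
    rw [map_sub, AlgEquiv.commutes, sub_sub_sub_cancel_right]
  obtain ⟨d, hd⟩ := exists_sum_binom_eq_of_pow_prime_fixed hσ hσx hfix
  have hle := hy.le_val_apply_sum hv hshift (hd.symm ▸ hc)
  rwa [hd, action_Psi₂_apply, hsub, show (p + p * u : ℤ) = p * (u + 1) by ring] at hle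

theorem le_val_eval_map_sub [FiniteDimensional κ⸨X⸩ L] {f : Polynomial L}
    (hfix : ∀ k, (σ ^ p) (f.coeff k) = f.coeff k) (hf : ∀ k, 0 ≤ v (f.coeff k)) {z : L}
    (hz : 0 ≤ v z) :
    ((p * (u + 1) : ℤ) : WithTop ℤ) ≤ v ((f.map (σ : L →+* L)).eval z - f.eval z) := by
  rw [← Polynomial.eval_sub, Polynomial.eval_eq_sum_range]
  refine v.map_le_sum fun k _ => ?_
  rw [Polynomial.coeff_sub, Polynomial.coeff_map, RingHom.coe_coe]
  have hzk : ((0 : ℤ) : WithTop ℤ) ≤ v (z ^ k) := by simpa using le_val_pow (a := 0) hz k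
  simpa using le_val_mul
    (hv.le_val_sub_of_fixed hdeg hσ hσx hu hpu hx (hfix k) (hf k)) hzk

/- The characteristic polynomial `f` of `π` over the fixed field of `σ ^ p` satisfies
`(σ f) π - f π = (σ f) π = ∏ (π - σ g π)`, the product being over the powers `g` of `σ ^ p`;
each `σ g` is a generator of the group, so that each factor has value `b + 1`. -/
theorem le_ramificationNumber [FiniteDimensional κ⸨X⸩ L] {π : L} {b : ℤ} (hπ : v π = 1)
    (hb : v (σ π - π) = ((b + 1 : ℤ) : WithTop ℤ)) : u ≤ b := by
  have hp0 : (0 : ℤ) < p := by exact_mod_cast hp.out.pos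
  have hord : orderOf σ = p ^ 2 := by
    rw [orderOf_eq_card_of_forall_mem_zpowers hσ, IsGalois.card_aut_eq_finrank, hdeg]
  let H := Subgroup.zpowers (σ ^ p)
  have : Fintype H := Fintype.ofFinite H
  have hcard : Fintype.card H = p := by
    rw [← Nat.card_eq_fintype_card, Nat.card_zpowers, orderOf_pow, hord, pow_two,
      Nat.gcd_eq_right (dvd_mul_right p p), Nat.mul_div_cancel _ hp.out.pos]
  let f := MulSemiringAction.charpoly H π
  have hfix : ∀ k, (σ ^ p) (f.coeff k) = f.coeff k := fun k =>
    MulSemiringAction.smul_coeff_charpoly π k (⟨σ ^ p, Subgroup.mem_zpowers _⟩ : H)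
  have hint : ∀ k, 0 ≤ v (f.coeff k) := coeff_prod_X_sub_C_mem (S := valRing v) fun g _ => by
    change 0 ≤ v ((g : L ≃ₐ[κ⸨X⸩] L) π)
    rw [hv.val_algEquiv, hπ]
    exact zero_le_one
  have hconj : ∀ g : H, v (π - σ (g • π)) = ((b + 1 : ℤ) : WithTop ℤ) := by
    rintro ⟨g, hg⟩
    obtain ⟨i, rfl⟩ := mem_powers_iff_mem_zpowers.2 hg
    have hcop : (p * i + 1).Coprime (orderOf σ) := by
      rw [hord]
      exact Nat.Coprime.pow_right 2 (by simp)
    rw [v.map_sub_swap, ← hb, ← hv.val_pow_sub_eq_of_coprime π hcop, pow_succ', pow_mul]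
    rfl
  have heval : (f.map (σ : L →+* L)).eval π = ∏ g : H, (π - σ (g • π)) := by
    simp [f, MulSemiringAction.charpoly_eq, Polynomial.map_prod, Polynomial.eval_prod]
  have hle := hv.le_val_eval_map_sub hdeg hσ hσx hu hpu hx hfix hint (hπ ▸ zero_le_one)
  rw [MulSemiringAction.eval_charpoly, sub_zero, heval, val_prod_eq fun g _ => hconj g,
    Finset.sum_const, Finset.card_univ, hcard, nsmul_eq_mul] at hle
  have := le_of_mul_le_mul_left (WithTop.coe_le_coe.1 hle) hp0
  omega

end IsFullyRamifiedValuation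

end RamificationNumber

end Arithmetic

section AdaptedGenerators

section

variable {L : Type*} [Field L] {v : AddValuation L (WithTop ℤ)}

theorem exists_val_eq_of_eq_pow_mul_add {n : ℕ} (hn : n ≠ 0) {a b c z : L} (h : a = z ^ n * b + c)
    {r : ℤ} (hb : v b = r) (hlt : v a < v c) :
    ∃ k : ℤ, v z = k ∧ v a = ((n * k + r : ℤ) : WithTop ℤ) := by
  have hsub : a - c = z ^ n * b := by rw [h, add_sub_cancel_right]
  have ha : v a = v (z ^ n * b) := by rw [← hsub, v.map_sub_eq_of_lt_left hlt]
  have hz : z ≠ 0 := by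
    rintro rfl
    rw [zero_pow hn, zero_mul, v.map_zero] at ha
    exact not_top_lt (ha ▸ hlt)
  obtain ⟨k, hk⟩ := exists_val_eq (v := v) hz
  exact ⟨k, hk, by rw [ha, val_mul_eq (val_pow_eq hk n) hb]⟩

end

theorem exists_orderTop_eq {κ : Type*} [Field κ] {p : ℕ} (hp : p ≠ 0) {u b : ℤ} (hb : 0 ≤ b)
    {β₁ β₂ μ ε : κ⸨X⸩} (hβ₁ : β₁.orderTop = ((-u : ℤ) : WithTop ℤ)) (hμε : β₂ = μ ^ p * β₁ + ε)
    (hcond₁ : p • β₂.orderTop + ((((p : ℤ) - 1) * b : ℤ) : WithTop ℤ) < p • ε.orderTop)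
    (hcond₂ : p • β₂.orderTop + ((((p : ℤ) - 1) * b : ℤ) : WithTop ℤ) <
      p • (β₁ ^ p).orderTop) :
    ∃ m : ℤ, μ.orderTop = ((-m : ℤ) : WithTop ℤ) ∧ p ^ 2 * u < p * (p * m + u) - (p - 1) * b ∧
      ((-(p * (p * m + u)) + (p - 1) * b : ℤ) : WithTop ℤ) < p • ε.orderTop := by
  have hpb : (0 : ℤ) ≤ (p - 1) * b := mul_nonneg (by omega) hb
  have hlt : β₂.orderTop < ε.orderTop := by
    refine lt_of_nsmul_lt_nsmul_right p (lt_of_le_of_lt ?_ hcond₁)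
    exact le_add_of_nonneg_right (by exact_mod_cast hpb)
  simp only [← HahnSeries.addVal_apply (Γ := ℤ)] at hβ₁ hcond₁ hcond₂ hlt ⊢
  obtain ⟨k, hk, hβ₂⟩ := exists_val_eq_of_eq_pow_mul_add hp hμε hβ₁ hlt
  rw [hβ₂, ← WithTop.coe_nsmul, ← WithTop.coe_add, nsmul_eq_mul] at hcond₁ hcond₂
  rw [val_pow_eq hβ₁, ← WithTop.coe_nsmul, WithTop.coe_lt_coe, nsmul_eq_mul] at hcond₂
  refine ⟨-k, by rw [neg_neg, hk], by linarith, ?_⟩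
  convert hcond₁ using 2
  ring

theorem IsFullyRamifiedValuation.le_val_algebraMap_of_lt_nsmul {κ : Type*} [Field κ] {L : Type*}
    [Field L] [Algebra κ⸨X⸩ L] {v : AddValuation L (WithTop ℤ)}
    (hv : IsFullyRamifiedValuation κ v) {n : ℕ} (hn : 0 < n)
    (hdeg : Module.finrank κ⸨X⸩ L = n ^ 2) {a : κ⸨X⸩} {k : ℤ}
    (h : (k : WithTop ℤ) < n • a.orderTop) :
    ((n * k + 1 : ℤ) : WithTop ℤ) ≤ v (algebraMap κ⸨X⸩ L a) := by
  rw [hv.ramification, hdeg, pow_two, mul_nsmul]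
  generalize n • a.orderTop = s at h
  induction s with
  | top =>
    obtain ⟨m, rfl⟩ := Nat.exists_eq_succ_of_ne_zero hn.ne'
    simp [succ_nsmul]
  | coe s =>
    have hks : k + 1 ≤ s := WithTop.coe_lt_coe.1 h
    rw [← WithTop.coe_nsmul, nsmul_eq_mul]
    exact_mod_cast (by nlinarith : (n * k + 1 : ℤ) ≤ n * s)

section

variable {p : ℕ} [hp : Fact p.Prime] {L : Type*} [Field L] [CharP L p] {x₁ x₂ B M E : L}
  (hx₁ : x₁ ^ p - x₁ = B) (hx₂ : x₂ ^ p - x₂ = wittPoly p x₁ B + (M ^ p * B + E))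

include hx₁ hx₂

theorem sub_mul_pow_sub_self :
    (x₂ - M * x₁) ^ p - (x₂ - M * x₁) = -((M ^ p - M) * x₁) + (wittPoly p x₁ B + E) := by
  rw [sub_pow_char, mul_pow]
  linear_combination hx₂ - M ^ p * hx₁

theorem val_sub_mul {v : AddValuation L (WithTop ℤ)} {u m : ℤ} (hu : 0 < u)
    (hum : (p - 1) * u < p * m) (hvx : v x₁ = ((-(p * u) : ℤ) : WithTop ℤ))
    (hvM : v M = ((-(p ^ 2 * m) : ℤ) : WithTop ℤ))
    (hE : ((p * -(p ^ 2 * m + u) + 1 : ℤ) : WithTop ℤ) ≤ v E) :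
    v (x₂ - M * x₁) = ((-(p ^ 2 * m + u) : ℤ) : WithTop ℤ) := by
  have hp1 : (1 : ℤ) < p := by exact_mod_cast hp.out.one_lt
  have hm : 0 < m := by nlinarith
  have hpm : 0 < p ^ 2 * m := by positivity
  have hpu : 0 < p * u := by positivity
  have hpum : (p : ℤ) ^ 2 * ((p - 1) * u) < p ^ 2 * (p * m) :=
    mul_lt_mul_of_pos_left hum (by positivity)
  refine val_eq_of_val_pow_sub hp.out.one_lt (by linarith) ?_
  rw [sub_mul_pow_sub_self hx₁ hx₂]
  refine val_add_eq ?_ (v.map_le_add ?_ hE)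
  · rw [v.map_neg, val_mul_eq (val_pow_sub_self hp.out.one_lt (by linarith) hvM) hvx]
    congr 1
    ring
  · have hvB : v B = ((p * -(p * u) : ℤ) : WithTop ℤ) :=
      hx₁ ▸ val_pow_sub_self hp.out.one_lt (by linarith) hvx
    refine le_val_wittPoly hvx.ge hvB.ge fun i hi _ => ?_
    have : 0 ≤ (i - 1) * ((p - 1) * (p * u)) :=
      mul_nonneg (by omega) (mul_nonneg (by omega) hpu.le)
    nlinarith

end

/-- Generators `x` and `y` of a cyclic extension of degree `p²` adapted to its ramification: in
terms of the Artin-Schreier-Witt generators, `x = x₁`, `y = x₂ - μ x₁` and `w = W(x₁, 1)`. Then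
`σ₁ σ₂^[μ]` moves `y` only by `w`, whose value is large compared with that of `y`. -/
structure AdaptedGenerators (p : ℕ) {K L : Type*} [Field K] [Field L] [Algebra K L]
    (v : AddValuation L (WithTop ℤ)) (σ₁ σ₂ : L ≃ₐ[K] L) (μ : K) (b₁ b₂ : ℤ) (x y w : L) :
    Prop where
  apply₁_x : σ₁ x = x + 1
  apply₂_x : σ₂ x = x
  apply₁_y : σ₁ y = y + w - algebraMap K L μ
  apply₂_y : σ₂ y = y + 1
  val_x : v x = ((-(p * b₁) : ℤ) : WithTop ℤ)
  val_y : v y = ((-b₂ : ℤ) : WithTop ℤ)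
  le_val_w : ((-((p - 1) * (p * b₁)) : ℤ) : WithTop ℤ) ≤ v w
  pos : 0 < b₁
  not_dvd : ¬ (p : ℤ) ∣ b₁
  lt : p ^ 2 * b₁ < b₂
  dvd_sub : (p : ℤ) ^ 2 ∣ b₂ - b₁

section

variable {p : ℕ} [hp : Fact p.Prime] {κ : Type*} [Field κ] [CharP κ p]
  {L : Type*} [Field L] [Algebra κ⸨X⸩ L] {v : AddValuation L (WithTop ℤ)}
  (hv : IsFullyRamifiedValuation κ v) (hdeg : Module.finrank κ⸨X⸩ L = p ^ 2)

include hv hdeg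

theorem AdaptedGenerators.of_val [FiniteDimensional κ⸨X⸩ L] {σ₁ σ₂ : L ≃ₐ[κ⸨X⸩] L}
    {π : L} (hπ : v π = 1) {b₁ b₂ : ℤ} (hb₁ : v (σ₁ π - π) = ((b₁ + 1 : ℤ) : WithTop ℤ))
    (hb₂ : v (σ₂ π - π) = ((b₂ + 1 : ℤ) : WithTop ℤ)) (hb₁0 : 1 ≤ b₁) (hb₂0 : 1 ≤ b₂)
    {x y w : L} {μ : κ⸨X⸩}
    (hσ₁x : σ₁ x = x + 1) (hσ₂x : σ₂ x = x) (hσ₁y : σ₁ y = y + w - algebraMap κ⸨X⸩ L μ)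
    (hσ₂y : σ₂ y = y + 1) {u m : ℤ} (hu : 0 < u) (hpu : ¬ (p : ℤ) ∣ u)
    (hum : (p ^ 2 - 1) * u < p ^ 2 * m) (hx : v x = ((-(p * u) : ℤ) : WithTop ℤ))
    (hy : v y = ((-(p ^ 2 * m + u) : ℤ) : WithTop ℤ))
    (hw : ((-((p - 1) * (p * u)) : ℤ) : WithTop ℤ) ≤ v w)
    (hμ : v (algebraMap κ⸨X⸩ L μ) = ((-(p ^ 2 * m) : ℤ) : WithTop ℤ)) :
    AdaptedGenerators p v σ₁ σ₂ μ b₁ b₂ x y w := by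
  have hp1 : (1 : ℤ) < p := by exact_mod_cast hp.out.one_lt
  have hdvd : p ∣ Module.finrank κ⸨X⸩ L := hdeg ▸ dvd_pow_self p two_ne_zero
  have hpk : ¬ (p : ℤ) ∣ -(p ^ 2 * m + u) := by
    rwa [dvd_neg, dvd_add_right (Dvd.dvd.mul_right (dvd_pow_self (p : ℤ) two_ne_zero) m)]
  have hub₁ : b₁ = u := by
    have hΨ := hv.val_Psi₂ hπ hb₁ hdvd hb₁0 hy hpk
    have hlt : ((-(p ^ 2 * m) + 1 : ℤ) : WithTop ℤ) ≤ v w :=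
      le_trans (WithTop.coe_le_coe.2 (by nlinarith)) hw
    rw [action_Psi₂_apply, hσ₁y, show y + w - algebraMap κ⸨X⸩ L μ - y =
      -algebraMap κ⸨X⸩ L μ + w by ring, val_add_eq (by rw [v.map_neg, hμ]) hlt] at hΨ
    have := WithTop.coe_injective hΨ
    omega
  have hub₂ : b₂ = p ^ 2 * m + u := by
    have hΨ := hv.val_Psi₂ hπ hb₂ hdvd hb₂0 hy hpk
    rw [action_Psi₂_apply, hσ₂y, add_sub_cancel_left, v.map_one] at hΨ
    have := WithTop.coe_injective (a₁ := (0 : ℤ)) hΨ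
    omega
  subst hub₁ hub₂
  exact ⟨hσ₁x, hσ₂x, hσ₁y, hσ₂y, hx, hy, hw, hu, hpu, by linarith, ⟨m, by ring⟩⟩

theorem IsFullyRamifiedValuation.adaptedGenerators [IsGalois κ⸨X⸩ L] [FiniteDimensional κ⸨X⸩ L]
    {σ : L ≃ₐ[κ⸨X⸩] L} (hσ : ∀ τ : L ≃ₐ[κ⸨X⸩] L, τ ∈ Subgroup.zpowers σ)
    {π : L} (hπ : v π = 1) {b₁ b₂ : ℤ} (hb₁ : v (σ π - π) = ((b₁ + 1 : ℤ) : WithTop ℤ))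
    (hb₂ : v ((σ ^ p) π - π) = ((b₂ + 1 : ℤ) : WithTop ℤ)) {β₁ β₂ μ ε : κ⸨X⸩}
    (hβ₁ : ∀ c : κ⸨X⸩, (β₁ + (c ^ p - c)).orderTop ≤ β₁.orderTop) {x₁ x₂ : L}
    (hx₁ : x₁ ^ p - x₁ = algebraMap κ⸨X⸩ L β₁)
    (hx₂ : x₂ ^ p - x₂ = wittPoly p x₁ (algebraMap κ⸨X⸩ L β₁) + algebraMap κ⸨X⸩ L β₂)
    (hσx₁ : σ x₁ - x₁ = 1) (hσx₂ : σ x₂ - x₂ = wittPoly p x₁ 1) (hμε : β₂ = μ ^ p * β₁ + ε)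
    (hcond₁ : p • β₂.orderTop + ((((p : ℤ) - 1) * b₁ : ℤ) : WithTop ℤ) < p • ε.orderTop)
    (hcond₂ : p • β₂.orderTop + ((((p : ℤ) - 1) * b₁ : ℤ) : WithTop ℤ) <
      p • (β₁ ^ p).orderTop) :
    AdaptedGenerators p v σ (σ ^ p) μ b₁ b₂ x₁ (x₂ - algebraMap κ⸨X⸩ L μ * x₁)
      (wittPoly p x₁ 1) := by
  have : CharP L p := charP_of_algebra_laurentSeries p κ L
  have hp1 : (1 : ℤ) < p := by exact_mod_cast hp.out.one_lt
  obtain ⟨u, hu, hpu, hβu, hvx⟩ :=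
    hv.exists_val_artinSchreier hdeg (hv.val_neg_of_sub_eq_one hσx₁) hβ₁ hx₁
  have hub : u ≤ b₁ := hv.le_ramificationNumber hdeg hσ hσx₁ hu hpu hvx hπ hb₁
  have hb₁b₂ : b₁ + 1 ≤ b₂ + 1 :=
    WithTop.coe_le_coe.1 (hb₁ ▸ hb₂ ▸ hv.le_val_pow_sub σ π p)
  obtain ⟨m, hμ, hum, hε⟩ := exists_orderTop_eq hp.out.ne_zero (by omega) hβu hμε hcond₁ hcond₂
  have hub' : (p - 1) * u ≤ (p - 1) * b₁ := mul_le_mul_of_nonneg_left hub (by omega)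
  have hvM : v (algebraMap κ⸨X⸩ L μ) = ((-(p ^ 2 * m) : ℤ) : WithTop ℤ) := by
    rw [hv.val_algebraMap hμ, hdeg, Nat.cast_pow, mul_neg]
  have hE : ((p * -(p ^ 2 * m + u) + 1 : ℤ) : WithTop ℤ) ≤ v (algebraMap κ⸨X⸩ L ε) :=
    le_trans (WithTop.coe_le_coe.2 (by nlinarith))
      (hv.le_val_algebraMap_of_lt_nsmul hp.out.pos hdeg hε)
  have hw : ((-((p - 1) * (p * u)) : ℤ) : WithTop ℤ) ≤ v (wittPoly p x₁ 1) :=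
    le_val_wittPoly hvx.ge (c := 0) (by simp) fun i _ _ => by
      have : 0 < (p : ℤ) * u := by positivity
      nlinarith
  have hσ₂x : (σ ^ p) x₁ = x₁ := pow_prime_apply_eq_self hσx₁
  refine .of_val hv hdeg hπ hb₁ hb₂ (by omega) (by omega) (sub_eq_iff_eq_add'.1 hσx₁) hσ₂x
    ?_ ?_ hu hpu (by nlinarith) hvx
    (val_sub_mul hx₁ (by rw [hx₂, hμε, map_add, map_mul, map_pow]) hu (by nlinarith) hvx hvM hE)
    hw hvM
  · rw [map_sub, map_mul, AlgEquiv.commutes, sub_eq_iff_eq_add'.1 hσx₁, sub_eq_iff_eq_add'.1 hσx₂]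
    ring
  · rw [map_sub, map_mul, AlgEquiv.commutes, hσ₂x, pow_prime_apply_eq_add_one hσx₁ hσx₂]
    ring

end

end AdaptedGenerators

section Scaffold

section

variable {K L : Type*} [Field K] [Field L] [Algebra K L] {σ : L ≃ₐ[K] L} {y z : L}

theorem action_Psi₂_mul_of_fixed (hz : σ z = z) (a : L) :
    action (Psi₂ σ) (a * z) = action (Psi₂ σ) a * z := by
  simp only [action_Psi₂_apply, map_mul, hz, sub_mul]

theorem action_Psi₂_pow_mul_of_fixed (hz : σ z = z) (k : ℕ) (a : L) :
    action (Psi₂ σ ^ k) (a * z) = action (Psi₂ σ ^ k) a * z := by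
  induction k with
  | zero => simp
  | succ k ih =>
    simp only [pow_succ', map_mul, Module.End.mul_apply] at ih ⊢
    rw [ih, action_Psi₂_mul_of_fixed hz]

variable {p : ℕ} [Fact p.Prime] [CharP L p]

theorem Psi₂_pow_binom_eq_zero (hy : σ y - y = 1) {i k : ℕ} (hi : i < p) (hik : i < k) :
    action (Psi₂ σ ^ k) (binom y i) = 0 := by
  obtain ⟨d, rfl⟩ := Nat.exists_eq_add_of_lt hik
  have h : action (Psi₂ σ ^ i) (binom y i) = 1 := by
    rw [← binom_zero y]
    exact Psi₂_pow_binom (p := p) hy i (j := 0) hi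
  rw [show i + d + 1 = d + 1 + i by ring, pow_add, map_mul, Module.End.mul_apply, h, pow_succ,
    map_mul, Module.End.mul_apply, action_Psi₂_apply, map_one, sub_self, map_zero]

/- As `σ - 1` lowers the index of `binom y i`, this is Vandermonde's identity. -/
theorem action_truncPow_binom_mul (hy : σ y - y = 1) (hz : σ z = z) (c : K) {i : ℕ} (hi : i < p) :
    action (truncPow p (grp σ) c) (binom y i * z) = binom (y + algebraMap K L c) i * z := by
  have hterm : ∀ k ∈ Finset.range (i + 1), action (binom c k • Psi₂ σ ^ k) (binom y i * z) =
      binom (algebraMap K L c) k * binom y (i - k) * z := by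
    intro k hk
    have hki : k + (i - k) = i := Nat.add_sub_cancel' (Finset.mem_range_succ_iff.1 hk)
    have hlow : action (Psi₂ σ ^ k) (binom y i) = binom y (i - k) := by
      rw [← Psi₂_pow_binom (p := p) hy k (by omega : k + (i - k) < p), hki]
    rw [map_smul, LinearMap.smul_apply, action_Psi₂_pow_mul_of_fixed hz, hlow, Algebra.smul_def,
      map_binom, mul_assoc]
  have hvanish : ∀ k ∈ Finset.range p, k ∉ Finset.range (i + 1) →
      action (binom c k • Psi₂ σ ^ k) (binom y i * z) = 0 := by
    intro k _ hk
    rw [map_smul, LinearMap.smul_apply, action_Psi₂_pow_mul_of_fixed hz,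
      Psi₂_pow_binom_eq_zero hy hi (by simpa [Nat.lt_succ_iff] using hk), zero_mul, smul_zero]
  change action (∑ k ∈ Finset.range p, binom c k • Psi₂ σ ^ k) (binom y i * z) = _
  rw [map_sum, LinearMap.sum_apply,
    ← Finset.sum_subset (Finset.range_subset_range.2 hi) hvanish, Finset.sum_congr rfl hterm,
    add_comm y, binom_add p _ _ hi, Finset.Nat.sum_antidiagonal_eq_sum_range_succ_mk,
    Finset.sum_mul]

theorem action_Psi₁_apply (p : ℕ) (σ₁ σ₂ : L ≃ₐ[K] L) (μ : K) (z : L) :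
    action (Psi₁ p σ₁ σ₂ μ) z = σ₁ (action (truncPow p (grp σ₂) μ) z) - z := by
  rw [Psi₁, map_sub, map_one, map_mul, LinearMap.sub_apply, Module.End.mul_apply, action_grp,
    Module.End.one_apply]

end

namespace AdaptedGenerators

variable {p : ℕ} {κ : Type*} [Field κ] {L : Type*} [Field L] [Algebra κ⸨X⸩ L]
  {v : AddValuation L (WithTop ℤ)} {σ₁ σ₂ : L ≃ₐ[κ⸨X⸩] L} {μ : κ⸨X⸩} {b₁ b₂ : ℤ} {x y w : L}
  (h : AdaptedGenerators p v σ₁ σ₂ μ b₁ b₂ x y w)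

include h

theorem apply₂_binom_x (j : ℕ) : σ₂ (binom x j) = binom x j := by
  have := map_binom (σ₂ : L →+* L) x j
  rwa [RingHom.coe_coe, h.apply₂_x] at this

theorem apply₂_y_sub : σ₂ y - y = 1 := by rw [h.apply₂_y, add_sub_cancel_left]

theorem action_Psi₂_binom_zero (j : ℕ) : action (Psi₂ σ₂) (binom y 0 * binom x j) = 0 := by
  rw [action_Psi₂_mul_of_fixed (h.apply₂_binom_x j), action_Psi₂_apply, binom_zero, map_one,
    sub_self, zero_mul]

variable [hp : Fact p.Prime]

theorem prime_mul_pos : 0 < p * b₁ := mul_pos (by exact_mod_cast hp.out.pos) h.pos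

theorem pos₂ : 0 < b₂ :=
  (mul_pos (pow_pos (by exact_mod_cast hp.out.pos) 2) h.pos).trans h.lt

theorem eq_of_dvd_sub {i j i' j' : Fin p}
    (hd : (p : ℤ) ^ 2 ∣ -(i * b₂ + j * (p * b₁) : ℤ) - -(i' * b₂ + j' * (p * b₁))) :
    i = i' ∧ j = j' := by
  have hp' := Nat.prime_iff_prime_int.1 hp.out
  obtain ⟨m, hm⟩ := h.dvd_sub
  have hcop : IsCoprime ((p : ℤ) ^ 2) b₁ := ((hp'.coprime_iff_not_dvd).2 h.not_dvd).pow_left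
  have hdigits : (p : ℤ) ^ 2 ∣ (i : ℕ) - (i' : ℕ) + ((j : ℕ) - (j' : ℕ)) * p := by
    refine hcop.dvd_of_dvd_mul_left ?_
    obtain ⟨q, hq⟩ := hd
    exact ⟨-q - ((i : ℕ) - (i' : ℕ)) * m, by linear_combination -hq - ((i : ℤ) - i') * hm⟩
  obtain rfl : i = i' := by
    have := (dvd_pow_self (p : ℤ) two_ne_zero).trans hdigits
    exact fin_eq_of_dvd_sub ((dvd_add_left (dvd_mul_left _ _)).1 this)
  rw [sub_self, zero_add, pow_two, mul_dvd_mul_iff_right hp'.ne_zero] at hdigits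
  exact ⟨rfl, fin_eq_of_dvd_sub hdigits⟩

variable [CharP κ p]

theorem action_Psi₂_binom_succ {i : ℕ} (hi : i + 1 < p) (j : ℕ) :
    action (Psi₂ σ₂) (binom y (i + 1) * binom x j) = binom y i * binom x j := by
  have : CharP L p := charP_of_algebra_laurentSeries p κ L
  rw [action_Psi₂_mul_of_fixed (h.apply₂_binom_x j), Psi₂_binom_succ (p := p) h.apply₂_y_sub hi]

theorem action_Psi₁_binom {i : ℕ} (hi : i < p) (j : ℕ) :
    action (Psi₁ p σ₁ σ₂ μ) (binom y i * binom x j) =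
      binom (y + w) i * binom (x + 1) j - binom y i * binom x j := by
  have : CharP L p := charP_of_algebra_laurentSeries p κ L
  have hy := map_binom (σ₁ : L →+* L) (y + algebraMap κ⸨X⸩ L μ) i
  have hx := map_binom (σ₁ : L →+* L) x j
  simp only [RingHom.coe_coe, map_add, AlgEquiv.commutes, h.apply₁_x, h.apply₁_y,
    sub_add_cancel] at hy hx
  rw [action_Psi₁_apply, action_truncPow_binom_mul h.apply₂_y_sub (h.apply₂_binom_x j) μ hi,
    map_mul, hy, hx]

variable (hv : IsFullyRamifiedValuation κ v)

include hv

theorem val_binom_mul_binom {i j : ℕ} (hi : i < p) (hj : j < p) :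
    v (binom y i * binom x j) = ((-(i * b₂ + j * (p * b₁)) : ℤ) : WithTop ℤ) := by
  rw [val_mul_eq (hv.val_binom hi h.pos₂ h.val_y) (hv.val_binom hj h.prime_mul_pos h.val_x),
    neg_add]

theorem incongruentValues (hdeg : Module.finrank κ⸨X⸩ L = p ^ 2) :
    IncongruentValues κ v (fun a : Fin p × Fin p => binom y a.1 * binom x a.2)
      (fun a => -(a.1 * b₂ + a.2 * (p * b₁))) where
  val_eq a := h.val_binom_mul_binom hv a.1.2 a.2.2
  incongruent a b hab := by
    rw [hdeg, Nat.cast_pow] at hab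
    exact Prod.ext_iff.2 (h.eq_of_dvd_sub hab)

theorem le_val_binom_add_sub {i j : ℕ} (hi : i < p) (hj : j < p) :
    ((-(i * b₂ + j * (p * b₁)) + p * b₁ + 1 : ℤ) : WithTop ℤ) ≤
      v ((binom (y + w) i - binom y i) * binom (x + 1) j) := by
  have : CharP L p := charP_of_algebra_laurentSeries p κ L
  have hp1 : (1 : ℤ) < p := by exact_mod_cast hp.out.one_lt
  have hpb := h.prime_mul_pos
  have hx1 : v (x + 1) = ((-(p * b₁) : ℤ) : WithTop ℤ) :=
    val_add_eq h.val_x (by rw [v.map_one]; exact_mod_cast (by omega : -(p * b₁ : ℤ) + 1 ≤ 0))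
  rw [binom_add p _ _ hi, Finset.Nat.sum_antidiagonal_eq_sum_range_succ_mk,
    Finset.sum_range_succ, Nat.sub_self, binom_zero, mul_one, add_sub_cancel_right, Finset.sum_mul]
  refine v.map_le_sum fun k hk => ?_
  obtain ⟨l, rfl⟩ := Nat.exists_eq_add_of_lt (Finset.mem_range.1 hk)
  rw [show k + l + 1 - k = l + 1 by omega]
  refine le_trans (WithTop.coe_le_coe.2 ?_) (le_val_mul (le_val_mul
    (hv.val_binom (show k < p by omega) h.pos₂ h.val_y).ge
    (hv.le_val_binom (show l + 1 < p by omega) (mul_nonneg (by omega) hpb.le) h.le_val_w))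
    (hv.val_binom hj hpb hx1).ge)
  have hlt := h.lt
  have hl : 0 ≤ (l : ℤ) * (b₂ - (p - 1) * (p * b₁)) := mul_nonneg (by omega) (by nlinarith)
  push_cast
  nlinarith

theorem val_action_Psi₁_binom_succ {i j : ℕ} (hi : i < p) (hj : j + 1 < p) :
    v (action (Psi₁ p σ₁ σ₂ μ) (binom y i * binom x (j + 1))) =
      ((-(i * b₂ + (j + 1 : ℕ) * (p * b₁)) + p * b₁ : ℤ) : WithTop ℤ) := by
  have : CharP L p := charP_of_algebra_laurentSeries p κ L
  have hsplit : binom (y + w) i * binom (x + 1) (j + 1) - binom y i * binom x (j + 1) =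
      binom y i * binom x j + (binom (y + w) i - binom y i) * binom (x + 1) (j + 1) := by
    rw [binom_add_one p x hj]
    ring
  have hmain := h.val_binom_mul_binom hv hi (Nat.lt_of_succ_lt hj)
  rw [show (-(i * b₂ + j * (p * b₁)) : ℤ) = -(i * b₂ + (j + 1 : ℕ) * (p * b₁)) + p * b₁ by
    push_cast
    ring] at hmain
  rw [h.action_Psi₁_binom hi, hsplit]
  exact val_add_eq hmain (h.le_val_binom_add_sub hv hi hj)

theorem le_val_action_Psi₁_binom {i j : ℕ} (hi : i < p) (hj : j < p) :
    ((-(i * b₂ + j * (p * b₁)) + p * b₁ : ℤ) : WithTop ℤ) ≤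
      v (action (Psi₁ p σ₁ σ₂ μ) (binom y i * binom x j)) := by
  rcases j with _ | j
  · have hle := h.le_val_binom_add_sub hv hi hj
    rw [binom_zero, sub_mul, ← binom_zero x] at hle
    rw [h.action_Psi₁_binom hi, binom_zero, ← binom_zero x]
    exact (WithTop.coe_le_coe.2 (by omega)).trans hle
  · exact (h.val_action_Psi₁_binom_succ hv hi hj).ge

theorem val_action_Psi₂_binom_succ {i j : ℕ} (hi : i + 1 < p) (hj : j < p) :
    v (action (Psi₂ σ₂) (binom y (i + 1) * binom x j)) =
      ((-((i + 1 : ℕ) * b₂ + j * (p * b₁)) + b₂ : ℤ) : WithTop ℤ) := by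
  rw [h.action_Psi₂_binom_succ hi, h.val_binom_mul_binom hv (Nat.lt_of_succ_lt hi) hj]
  congr 1
  push_cast
  ring

theorem le_val_action_Psi₂_binom {i j : ℕ} (hi : i < p) (hj : j < p) :
    ((-(i * b₂ + j * (p * b₁)) + b₂ : ℤ) : WithTop ℤ) ≤
      v (action (Psi₂ σ₂) (binom y i * binom x j)) := by
  rcases i with _ | i
  · rw [h.action_Psi₂_binom_zero, v.map_zero]
    exact le_top
  · exact (h.val_action_Psi₂_binom_succ hv hi hj).ge

variable [FiniteDimensional κ⸨X⸩ L] (hdeg : Module.finrank κ⸨X⸩ L = p ^ 2)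

include hdeg

theorem val_action_Psi₁ {i j : ℕ} (hi : i < p) (hj : j + 1 < p) {z : L} {k : ℤ} (hz : v z = k)
    (hk : (p : ℤ) ^ 2 ∣ k + (i * b₂ + (j + 1 : ℕ) * (p * b₁))) :
    v (action (Psi₁ p σ₁ σ₂ μ) z) = ((k + p * b₁ : ℤ) : WithTop ℤ) :=
  (h.incongruentValues hv hdeg).val_apply_eq hv (by rw [hdeg]; simp [pow_two])
    (fun a => h.le_val_action_Psi₁_binom hv a.1.2 a.2.2) (i := (⟨i, hi⟩, ⟨j + 1, hj⟩))
    (h.val_action_Psi₁_binom_succ hv hi hj) hz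
    (by rwa [hdeg, Nat.cast_pow, sub_neg_eq_add])

theorem val_action_Psi₂ {i j : ℕ} (hi : i + 1 < p) (hj : j < p) {z : L} {k : ℤ} (hz : v z = k)
    (hk : (p : ℤ) ^ 2 ∣ k + ((i + 1 : ℕ) * b₂ + j * (p * b₁))) :
    v (action (Psi₂ σ₂) z) = ((k + b₂ : ℤ) : WithTop ℤ) :=
  (h.incongruentValues hv hdeg).val_apply_eq hv (by rw [hdeg]; simp [pow_two])
    (fun a => h.le_val_action_Psi₂_binom hv a.1.2 a.2.2) (i := (⟨i + 1, hi⟩, ⟨j, hj⟩))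
    (h.val_action_Psi₂_binom_succ hv hi hj) hz
    (by rwa [hdeg, Nat.cast_pow, sub_neg_eq_add])

theorem val_action_Psi₁_pow {i j s : ℕ} (hi : i < p) (hjs : j + s < p) {z : L} {k : ℤ}
    (hz : v z = k) (hk : (p : ℤ) ^ 2 ∣ k + (i * b₂ + (j + s : ℕ) * (p * b₁))) :
    v (action (Psi₁ p σ₁ σ₂ μ ^ s) z) = ((k + s * (p * b₁) : ℤ) : WithTop ℤ) := by
  induction s generalizing j with
  | zero => simpa using hz
  | succ s ih =>
    rw [pow_succ', map_mul, Module.End.mul_apply,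
      h.val_action_Psi₁ hv hdeg hi (by omega : j + 1 < p)
        (ih (j := j + 1) (by omega) (by rwa [add_right_comm]))]
    · congr 1
      push_cast
      ring
    · convert hk using 1
      push_cast
      ring

theorem val_action_Psi₂_pow {i j s : ℕ} (his : i + s < p) (hj : j < p) {z : L} {k : ℤ}
    (hz : v z = k) (hk : (p : ℤ) ^ 2 ∣ k + ((i + s : ℕ) * b₂ + j * (p * b₁))) :
    v (action (Psi₂ σ₂ ^ s) z) = ((k + s * b₂ : ℤ) : WithTop ℤ) := by
  induction s generalizing i with
  | zero => simpa using hz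
  | succ s ih =>
    rw [pow_succ', map_mul, Module.End.mul_apply,
      h.val_action_Psi₂ hv hdeg (by omega : i + 1 < p) hj
        (ih (i := i + 1) (by omega) (by rwa [add_right_comm]))]
    · congr 1
      push_cast
      ring
    · convert hk using 1
      push_cast
      ring

/- Modulo `p²` the value `r(b₂)` is that of `binom y (p - 1) * binom x (p - 1)`, the element on
which all the `Ψ^(a)` act by lowering indices. -/
theorem val_action_Psi {ρ : L} (hρ : v ρ = ((b₂ % (p : ℤ) ^ 2 : ℤ) : WithTop ℤ)) {a : ℕ}
    (ha : a < p ^ 2) :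
    v (action (Psi p σ₁ σ₂ μ a) ρ) =
      ((bb p b₁ b₂ a - p ^ 2 * (b₂ / (p : ℤ) ^ 2) : ℤ) : WithTop ℤ) := by
  obtain ⟨m, hm⟩ := h.dvd_sub
  have hmod := Int.emod_add_mul_ediv b₂ ((p : ℤ) ^ 2)
  have hp1 : ((p - 1 : ℕ) : ℤ) = p - 1 := by have := hp.out.pos; omega
  have hdiv : a / p < p := Nat.div_lt_of_lt_mul (by rwa [pow_two] at ha)
  have hlt : a % p < p := Nat.mod_lt _ hp.out.pos
  have hdvd : (p : ℤ) ^ 2 ∣ b₂ % p ^ 2 + ((p - 1 : ℕ) * b₂ + (p - 1 : ℕ) * (p * b₁)) :=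
    ⟨b₁ + p * m - b₂ / p ^ 2, by rw [hp1]; linear_combination hmod + (p : ℤ) * hm⟩
  have hΨ₁ := h.val_action_Psi₁_pow hv hdeg (i := p - 1) (j := p - 1 - a % p) (s := a % p)
    (by omega) (by omega) hρ (by rwa [Nat.sub_add_cancel (by omega)])
  rw [Psi, map_mul, Module.End.mul_apply,
    h.val_action_Psi₂_pow hv hdeg (i := p - 1 - a / p) (j := p - 1 - a % p) (by omega) (by omega)
      hΨ₁]
  · congr 1
    rw [bb]
    linear_combination hmod
  · have hcast : ((p - 1 - a % p : ℕ) : ℤ) = (p - 1 : ℕ) - (a % p : ℕ) := by omega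
    rw [Nat.sub_add_cancel (by omega), hcast]
    convert hdvd using 1
    ring

end AdaptedGenerators

end Scaffold

section Laurent

variable {κ : Type*} [Field κ]

theorem orderTop_single_one (k : ℤ) : (HahnSeries.single k (1 : κ)).orderTop = k :=
  HahnSeries.orderTop_single one_ne_zero

theorem zero_le_orderTop_iff_exists_powerSeries {c : κ⸨X⸩} :
    0 ≤ c.orderTop ↔ ∃ f : κ⟦X⟧, algebraMap κ⟦X⟧ κ⸨X⸩ f = c := by
  constructor
  · intro hc
    obtain ⟨n, hn⟩ := Int.eq_ofNat_of_zero_le (HahnSeries.zero_le_orderTop_iff.1 hc)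
    refine ⟨PowerSeries.X ^ n * c.powerSeriesPart, ?_⟩
    rw [LaurentSeries.coe_algebraMap]
    exact LaurentSeries.X_order_mul_powerSeriesPart hn.symm
  · rintro ⟨f, rfl⟩
    refine HahnSeries.le_orderTop_iff_forall.2 fun i hi => ?_
    rw [LaurentSeries.coe_algebraMap, PowerSeries.coeff_coe, if_pos (WithTop.coe_lt_coe.1 hi)]

theorem le_orderTop_iff_exists_powerSeries {c : κ⸨X⸩} {k : ℤ} :
    (k : WithTop ℤ) ≤ c.orderTop ↔ ∃ f : κ⟦X⟧, f • HahnSeries.single k (1 : κ) = c := by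
  constructor
  · intro h
    have hc : 0 ≤ (c * HahnSeries.single (-k) (1 : κ)).orderTop := by
      rw [HahnSeries.orderTop_mul, orderTop_single_one]
      simpa [← WithTop.coe_add] using add_le_add_left h ((-k : ℤ) : WithTop ℤ)
    obtain ⟨f, hf⟩ := zero_le_orderTop_iff_exists_powerSeries.1 hc
    refine ⟨f, ?_⟩
    rw [Algebra.smul_def, hf, mul_assoc, HahnSeries.single_mul_single, neg_add_cancel, mul_one]
    exact mul_one c
  · rintro ⟨f, rfl⟩
    rw [Algebra.smul_def, HahnSeries.orderTop_mul, orderTop_single_one]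
    exact le_add_of_nonneg_left (zero_le_orderTop_iff_exists_powerSeries.2 ⟨f, rfl⟩)

theorem le_orderTop_sum {ι : Type*} {s : Finset ι} {f : ι → κ⸨X⸩} {m : WithTop ℤ}
    (h : ∀ i ∈ s, m ≤ (f i).orderTop) : m ≤ (∑ i ∈ s, f i).orderTop := by
  simpa only [HahnSeries.addVal_apply] using (HahnSeries.addVal ℤ κ).map_le_sum
    (by simpa only [HahnSeries.addVal_apply] using h)

theorem eventually_le_orderTop_single_mul (c : κ⸨X⸩) (k : ℤ) :
    ∀ᶠ m : ℤ in Filter.atTop, (k : WithTop ℤ) ≤ (HahnSeries.single m (1 : κ) * c).orderTop := by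
  simp only [HahnSeries.orderTop_mul, orderTop_single_one]
  cases c.orderTop with
  | top => simp
  | coe l =>
    filter_upwards [Filter.eventually_ge_atTop (k - l)] with m hm
    exact_mod_cast (by omega : k ≤ m + l)

end Laurent

open Polynomial in
theorem coeff_mul_of_X_pow_dvd_mul {R : Type*} [CommRing R] [IsDomain R] {P Q : R[X]} {j : ℕ}
    (hQ : Q.coeff 0 ≠ 0) (h : X ^ j ∣ P * Q) : (P * Q).coeff j = P.coeff j * Q.coeff 0 := by
  obtain ⟨P, rfl⟩ := prime_X.pow_dvd_of_dvd_mul_right j (by rwa [X_dvd_iff]) h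
  simp only [mul_assoc, coeff_X_pow_mul', le_refl, if_true, Nat.sub_self, mul_coeff_zero]

open Polynomial in
theorem action_aeval_action_aeval {K L : Type*} [Field K] [Field L] [Algebra K L]
    (Ψ : MonoidAlgebra K (L ≃ₐ[K] L)) (P Q : K[X]) (z : L) :
    action (aeval Ψ P) (action (aeval Ψ Q) z) = action (aeval Ψ (P * Q)) z := by
  rw [map_mul, map_mul, Module.End.mul_apply]

/-- `w_j = min {d_{j+a} - d_a : 0 ≤ a ≤ j + a < N}` for `0 ≤ j < N`. -/
def IsMinDiff (N : ℕ) (d : ℕ → ℤ) (w : Fin N → ℤ) : Prop :=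
  ∀ j : Fin N, IsLeast {x | ∃ a, j + a < N ∧ d (j + a) - d a = x} (w j)

theorem IsMinDiff.coe_neg_le_iff {N : ℕ} {d : ℕ → ℤ} {w : Fin N → ℤ} (hw : IsMinDiff N d w)
    (j : Fin N) {m : WithTop ℤ} :
    ((-w j : ℤ) : WithTop ℤ) ≤ m ↔
      ∀ a : Fin N, (j + a : ℕ) < N → ((d a - d (j + a) : ℤ) : WithTop ℤ) ≤ m := by
  constructor
  · intro hm a ha
    have hle : w j ≤ d (j + a) - d a := (hw j).2 ⟨a, ha, rfl⟩
    exact le_trans (WithTop.coe_le_coe.2 (by omega)) hm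
  · intro hm
    obtain ⟨a, ha, hwa⟩ := (hw j).1
    rw [← hwa, neg_sub]
    exact hm ⟨a, by omega⟩ ha

/-- A scaffold for `L / K` given by the powers of a single nilpotent element `Ψ` of the group
algebra: the elements `Ψ ^ a • ρ`, `a < N = [L : K]`, have the pairwise incongruent values
`b a - N ⌊b 0 / N⌋`, so that `ρ` has value the residue of `b 0` modulo `N`. -/
structure PowerScaffold {K L : Type*} [Field K] [Field L] [Algebra K L]
    (v : AddValuation L (WithTop ℤ)) (Ψ : MonoidAlgebra K (L ≃ₐ[K] L)) (N : ℕ) (b : ℕ → ℤ)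
    (ρ : L) : Prop where
  finrank_eq : Module.finrank K L = N
  pow_eq_zero : Ψ ^ N = 0
  val_pow : ∀ a < N, v (action (Ψ ^ a) ρ) = ((b a - N * (b 0 / N) : ℤ) : WithTop ℤ)
  incongruent : ∀ i < N, ∀ j < N, (N : ℤ) ∣ b i - b j → i = j

namespace PowerScaffold

open Polynomial

theorem aeval_eq_sum {K L : Type*} [Field K] [Field L] [Algebra K L]
    {v : AddValuation L (WithTop ℤ)} {Ψ : MonoidAlgebra K (L ≃ₐ[K] L)} {N : ℕ} {b : ℕ → ℤ} {ρ : L}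
    (h : PowerScaffold v Ψ N b ρ) (P : K[X]) :
    aeval Ψ P = ∑ j : Fin N, P.coeff j • Ψ ^ (j : ℕ) := by
  rw [← Finset.sum_range fun j => P.coeff j • Ψ ^ j,
    aeval_eq_sum_range' (n := P.natDegree + 1 + N) (by omega)]
  refine (Finset.sum_subset (Finset.range_subset_range.2 (by omega)) fun j _ hj => ?_).symm
  rw [← Nat.add_sub_cancel' (not_lt.1 (Finset.mem_range.not.1 hj)), pow_add, h.pow_eq_zero,
    zero_mul, smul_zero]

variable {κ : Type*} [Field κ] {L : Type*} [Field L] [Algebra κ⸨X⸩ L]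
  {v : AddValuation L (WithTop ℤ)} {Ψ : MonoidAlgebra κ⸨X⸩ (L ≃ₐ[κ⸨X⸩] L)} {N : ℕ} {b : ℕ → ℤ}
  {ρ : L} (h : PowerScaffold v Ψ N b ρ)

include h

theorem action_aeval (P : κ⸨X⸩[X]) :
    action (aeval Ψ P) ρ = ∑ j : Fin N, P.coeff j • action (Ψ ^ (j : ℕ)) ρ := by
  rw [h.aeval_eq_sum, map_sum, LinearMap.sum_apply]
  simp only [map_smul, LinearMap.smul_apply]

theorem incongruentValues :
    IncongruentValues κ v (fun j : Fin N => action (Ψ ^ (j : ℕ)) ρ)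
      (fun j => b j - N * (b 0 / N)) where
  val_eq j := h.val_pow j j.2
  incongruent i j hij := by
    rw [h.finrank_eq, sub_sub_sub_cancel_right] at hij
    exact Fin.ext (h.incongruent i i.2 j j.2 hij)

variable (hv : IsFullyRamifiedValuation κ v)

include hv

theorem zero_le_val_smul_iff {j : ℕ} (hj : j < N) (c : κ⸨X⸩) :
    0 ≤ v (c • action (Ψ ^ j) ρ) ↔ ((b 0 / N - b j / N : ℤ) : WithTop ℤ) ≤ c.orderTop := by
  rcases eq_or_ne c 0 with rfl | hc
  · simp
  obtain ⟨k, hk, hval⟩ := hv.exists_val_smul hc (h.val_pow j hj)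
  have hN : (0 : ℤ) < N := by omega
  rw [hk, hval, h.finrank_eq, ← WithTop.coe_zero, WithTop.coe_le_coe, WithTop.coe_le_coe,
    show (N : ℤ) * k + (b j - N * (b 0 / N)) = b j - (b 0 / N - k) * N by ring, sub_nonneg,
    ← Int.le_ediv_iff_mul_le hN]
  omega

theorem mem_valRing_iff {P : κ⸨X⸩[X]} :
    action (aeval Ψ P) ρ ∈ valRing v ↔
      ∀ j : Fin N, ((b 0 / N - b j / N : ℤ) : WithTop ℤ) ≤ (P.coeff j).orderTop := by
  change 0 ≤ v _ ↔ _
  rw [h.action_aeval, h.incongruentValues.le_val_sum_iff hv]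
  exact forall_congr' fun j => h.zero_le_val_smul_iff hv j.2 _

theorem action_monomial_mem_valRing (j : ℕ) :
    action (aeval Ψ (monomial j (HahnSeries.single (b 0 / N - b j / N) (1 : κ)))) ρ ∈
      valRing v := by
  refine (h.mem_valRing_iff hv).2 fun i => ?_
  rw [coeff_monomial]
  split_ifs with hij
  · rw [hij, orderTop_single_one]
  · simp

theorem mem_valRing : ρ ∈ valRing v := by
  have hmem := h.action_monomial_mem_valRing hv 0
  rwa [sub_self, monomial_zero_left, HahnSeries.single_zero_one, map_one, map_one, map_one] at hmem

theorem action_aeval_eq_iff {P Q : κ⸨X⸩[X]} :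
    action (aeval Ψ P) ρ = action (aeval Ψ Q) ρ ↔ ∀ j < N, P.coeff j = Q.coeff j := by
  rw [h.action_aeval, h.action_aeval]
  constructor
  · intro heq j hj
    exact Fintype.linearIndependent_iffₛ.1 (h.incongruentValues.linearIndependent hv) _ _ heq
      ⟨j, hj⟩
  · exact fun heq => Finset.sum_congr rfl fun j _ => by rw [heq j j.2]

theorem linearIndependent_pow : LinearIndependent κ⸨X⸩ (fun j : Fin N => Ψ ^ (j : ℕ)) :=
  LinearIndependent.of_comp
    ((LinearMap.applyₗ ρ).comp (action (K := κ⸨X⸩) (L := L)).toLinearMap)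
    (h.incongruentValues.linearIndependent hv)

theorem linearIndependent_single_smul_pow (w : Fin N → ℤ) :
    LinearIndependent κ⟦X⟧ (fun j => HahnSeries.single (-w j) (1 : κ) • Ψ ^ (j : ℕ)) :=
  (LinearIndependent.iff_fractionRing κ⟦X⟧ κ⸨X⸩).2 ((h.linearIndependent_pow hv).units_smul
    fun j => Units.mk0 (HahnSeries.single (-w j) 1) (HahnSeries.single_ne_zero one_ne_zero))

theorem le_orderTop_coeff_of_mem_associatedOrder {P : κ⸨X⸩[X]}
    (hP : aeval Ψ P ∈ associatedOrder κ⸨X⸩ v) {i j : ℕ} (hij : i + j < N) :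
    ((b j / N - b (i + j) / N : ℤ) : WithTop ℤ) ≤ (P.coeff i).orderTop := by
  have hmem := hP _ (h.action_monomial_mem_valRing hv j)
  rw [action_aeval_action_aeval, h.mem_valRing_iff hv] at hmem
  have hle : ((b 0 / N - b (i + j) / N : ℤ) : WithTop ℤ) ≤ _ := hmem ⟨i + j, hij⟩
  rw [coeff_mul_monomial, HahnSeries.orderTop_mul, orderTop_single_one] at hle
  cases hc : (P.coeff i).orderTop with
  | top => exact le_top
  | coe c =>
    rw [hc, ← WithTop.coe_add, WithTop.coe_le_coe] at hle
    exact WithTop.coe_le_coe.2 (by omega)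

variable [FiniteDimensional κ⸨X⸩ L]

theorem exists_action_aeval_eq (z : L) : ∃ P : κ⸨X⸩[X], action (aeval Ψ P) ρ = z := by
  obtain ⟨c, rfl⟩ := h.incongruentValues.exists_sum_eq hv (by simp [h.finrank_eq]) z
  refine ⟨∑ j : Fin N, monomial j (c j), ?_⟩
  simp only [map_sum, aeval_monomial, ← Algebra.smul_def, LinearMap.sum_apply, map_smul,
    LinearMap.smul_apply]

theorem mem_associatedOrder_iff {P : κ⸨X⸩[X]} :
    aeval Ψ P ∈ associatedOrder κ⸨X⸩ v ↔
      ∀ i j : Fin N, (i + j : ℕ) < N →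
        ((b j / N - b (i + j) / N : ℤ) : WithTop ℤ) ≤ (P.coeff i).orderTop := by
  refine ⟨fun hP i j hij => h.le_orderTop_coeff_of_mem_associatedOrder hv hP hij, fun hP z hz => ?_⟩
  obtain ⟨Q, rfl⟩ := h.exists_action_aeval_eq hv z
  have hQ := (h.mem_valRing_iff hv).1 hz
  rw [action_aeval_action_aeval, h.mem_valRing_iff hv]
  intro k
  rw [coeff_mul]
  refine le_orderTop_sum fun ⟨i, j⟩ hij => ?_
  have hij : i + j = k := Finset.HasAntidiagonal.mem_antidiagonal.1 hij
  rw [HahnSeries.orderTop_mul]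
  refine le_trans (WithTop.coe_le_coe.2 ?_)
    (add_le_add (hP ⟨i, by omega⟩ ⟨j, by omega⟩ (by simp only; omega)) (hQ ⟨j, by omega⟩))
  simp only [hij]
  omega

theorem mem_associatedOrder_iff_of_isMinDiff {w : Fin N → ℤ}
    (hw : IsMinDiff N (fun a => b a / N) w) {P : κ⸨X⸩[X]} :
    aeval Ψ P ∈ associatedOrder κ⸨X⸩ v ↔
      ∀ j : Fin N, ((-w j : ℤ) : WithTop ℤ) ≤ (P.coeff j).orderTop := by
  rw [h.mem_associatedOrder_iff hv]
  exact forall_congr' fun j => (hw.coe_neg_le_iff j).symm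

variable [IsGalois κ⸨X⸩ L]

theorem exists_aeval_eq (α : MonoidAlgebra κ⸨X⸩ (L ≃ₐ[κ⸨X⸩] L)) :
    ∃ P : κ⸨X⸩[X], aeval Ψ P = α := by
  have basis := MonoidAlgebra.basis (L ≃ₐ[κ⸨X⸩] L) κ⸨X⸩
  have : Module.Finite κ⸨X⸩ (MonoidAlgebra κ⸨X⸩ (L ≃ₐ[κ⸨X⸩] L)) := .of_basis basis
  have hcard : Fintype.card (Fin N) =
      Module.finrank κ⸨X⸩ (MonoidAlgebra κ⸨X⸩ (L ≃ₐ[κ⸨X⸩] L)) := by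
    rw [Module.finrank_eq_nat_card_basis basis, IsGalois.card_aut_eq_finrank, h.finrank_eq,
      Fintype.card_fin]
  have hspan := (h.linearIndependent_pow hv).span_eq_top_of_card_eq_finrank' hcard
  obtain ⟨c, rfl⟩ := (Submodule.mem_span_range_iff_exists_fun κ⸨X⸩).1
    (hspan ▸ Submodule.mem_top : α ∈ _)
  exact ⟨∑ j : Fin N, monomial j (c j), by
    simp only [map_sum, aeval_monomial, ← Algebra.smul_def]⟩

theorem span_single_smul_pow {w : Fin N → ℤ} (hw : IsMinDiff N (fun a => b a / N) w) :
    (Submodule.span κ⟦X⟧ (Set.range fun j : Fin N =>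
      HahnSeries.single (-w j) (1 : κ) • Ψ ^ (j : ℕ)) :
        Set (MonoidAlgebra κ⸨X⸩ (L ≃ₐ[κ⸨X⸩] L))) = associatedOrder κ⸨X⸩ v := by
  ext α
  obtain ⟨P, rfl⟩ := h.exists_aeval_eq hv α
  rw [SetLike.mem_coe, SetLike.mem_coe, Submodule.mem_span_range_iff_exists_fun,
    h.mem_associatedOrder_iff_of_isMinDiff hv hw, h.aeval_eq_sum]
  simp only [le_orderTop_iff_exists_powerSeries, ← smul_assoc]
  constructor
  · rintro ⟨c, hc⟩ j
    exact ⟨c j, Fintype.linearIndependent_iffₛ.1 (h.linearIndependent_pow hv) _ _ hc j⟩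
  · intro hP
    choose c hc using hP
    exact ⟨c, Finset.sum_congr rfl fun j _ => by rw [hc]⟩

theorem action_apply_injective :
    Function.Injective fun α : MonoidAlgebra κ⸨X⸩ (L ≃ₐ[κ⸨X⸩] L) => action α ρ := by
  intro α β hαβ
  obtain ⟨P, rfl⟩ := h.exists_aeval_eq hv α
  obtain ⟨Q, rfl⟩ := h.exists_aeval_eq hv β
  rw [h.aeval_eq_sum, h.aeval_eq_sum]
  exact Finset.sum_congr rfl fun j _ => by rw [(h.action_aeval_eq_iff hv).1 hαβ j j.2]

theorem bijective_smul {w : Fin N → ℤ} (hw : IsMinDiff N (fun a => b a / N) w)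
    (hwb : ∀ j : Fin N, w j = b j / N - b 0 / N) :
    Function.Bijective fun α : associatedOrder κ⸨X⸩ v =>
      α • (⟨ρ, h.mem_valRing hv⟩ : valRing v) := by
  refine ⟨fun α β hαβ => Subtype.ext (h.action_apply_injective hv (congrArg Subtype.val hαβ)), ?_⟩
  rintro ⟨z, hz⟩
  obtain ⟨P, rfl⟩ := h.exists_action_aeval_eq hv z
  refine ⟨⟨aeval Ψ P, (h.mem_associatedOrder_iff_of_isMinDiff hv hw).2 fun j => ?_⟩, rfl⟩
  rw [hwb, neg_sub]
  exact (h.mem_valRing_iff hv).1 hz j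

theorem eventually_single_smul_mem (α : MonoidAlgebra κ⸨X⸩ (L ≃ₐ[κ⸨X⸩] L)) :
    ∀ᶠ m : ℤ in Filter.atTop, HahnSeries.single m (1 : κ) • α ∈ associatedOrder κ⸨X⸩ v := by
  obtain ⟨P, rfl⟩ := h.exists_aeval_eq hv α
  simp only [← map_smul, h.mem_associatedOrder_iff hv, coeff_smul, smul_eq_mul,
    Filter.eventually_all]
  exact fun i j _ => eventually_le_orderTop_single_mul _ _

theorem subsingleton_of_basis {ι : Type*}
    (basis : Module.Basis ι (associatedOrder κ⸨X⸩ v) (valRing v)) : Subsingleton ι := by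
  refine ⟨fun i j => ?_⟩
  by_contra hij
  obtain ⟨P, hP⟩ := h.exists_action_aeval_eq hv (basis i : L)
  obtain ⟨Q, hQ⟩ := h.exists_action_aeval_eq hv (basis j : L)
  obtain ⟨m, hPm, hQm⟩ := ((h.eventually_single_smul_mem hv (aeval Ψ P)).and
    (h.eventually_single_smul_mem hv (aeval Ψ Q))).exists
  -- As `Ψ` commutes with itself, `t ^ m Q(Ψ) • P(Ψ) ρ = t ^ m P(Ψ) • Q(Ψ) ρ`.
  have hrel : (⟨_, hQm⟩ : associatedOrder κ⸨X⸩ v) • basis i =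
      (⟨_, hPm⟩ : associatedOrder κ⸨X⸩ v) • basis j := by
    refine Subtype.ext ?_
    simp only [coe_smul, ← hP, ← hQ, map_smul, LinearMap.smul_apply, action_aeval_action_aeval,
      mul_comm P Q]
  have hzero : HahnSeries.single m (1 : κ) • aeval Ψ Q = 0 :=
    congrArg Subtype.val (by simpa [Ne.symm hij] using congrArg (basis.repr · i) hrel :
      (⟨_, hQm⟩ : associatedOrder κ⸨X⸩ v) = 0)
  have hQ0 := (smul_eq_zero.1 hzero).resolve_left (HahnSeries.single_ne_zero one_ne_zero)
  exact basis.ne_zero j (Subtype.ext (by rw [← hQ, hQ0, map_zero]; rfl))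

theorem exists_generator_of_free [Module.Free (associatedOrder κ⸨X⸩ v) (valRing v)] :
    ∃ z : valRing v, ∀ x, ∃ α : associatedOrder κ⸨X⸩ v, α • z = x := by
  obtain ⟨⟨ι, basis⟩⟩ := Module.Free.exists_basis (associatedOrder κ⸨X⸩ v) (valRing v)
  have := h.subsingleton_of_basis hv basis
  obtain ⟨i⟩ := basis.index_nonempty
  have : Fintype ι := Fintype.ofSubsingleton i
  refine ⟨basis i, fun x => ⟨basis.repr x i, ?_⟩⟩
  rw [← Fintype.sum_subsingleton (fun j => basis.repr x j • basis j) i, basis.sum_repr]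

/- The element of `𝔄` taking the generator `Q(Ψ) ρ` to the multiple of `Ψ ^ j ρ` generating its
`𝔒₀`-span inside `𝔒₂`. -/
theorem exists_coeff_mul_eq {Q : κ⸨X⸩[X]} (hQ : action (aeval Ψ Q) ρ ∈ valRing v)
    (hgen : ∀ x, ∃ α : associatedOrder κ⸨X⸩ v, α • (⟨_, hQ⟩ : valRing v) = x) (j : Fin N) :
    ∃ P : κ⸨X⸩[X], aeval Ψ P ∈ associatedOrder κ⸨X⸩ v ∧ X ^ (j : ℕ) ∣ P * Q ∧
      (P * Q).coeff j = HahnSeries.single (b 0 / N - b j / N) (1 : κ) := by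
  obtain ⟨⟨α, hα⟩, heq⟩ := hgen ⟨_, h.action_monomial_mem_valRing hv j⟩
  obtain ⟨P, rfl⟩ := h.exists_aeval_eq hv α
  have hcoeff := congrArg Subtype.val heq
  simp only [coe_smul, action_aeval_action_aeval, h.action_aeval_eq_iff hv, coeff_monomial]
    at hcoeff
  refine ⟨P, hα, X_pow_dvd_iff.2 fun i hi => ?_, ?_⟩
  · rw [hcoeff i (hi.trans j.2), if_neg hi.ne']
  · rw [hcoeff j j.2, if_pos rfl]

theorem minDiff_eq_of_free {w : Fin N → ℤ} (hw : IsMinDiff N (fun a => b a / N) w)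
    [Module.Free (associatedOrder κ⸨X⸩ v) (valRing v)] (j : Fin N) :
    w j = b j / N - b 0 / N := by
  obtain ⟨⟨z, hz⟩, hgen⟩ := h.exists_generator_of_free hv
  obtain ⟨Q, rfl⟩ := h.exists_action_aeval_eq hv z
  have hQ0 : Q.coeff 0 ≠ 0 := by
    obtain ⟨P, -, -, hP⟩ := h.exists_coeff_mul_eq hv hz hgen ⟨0, j.pos⟩
    rw [mul_coeff_zero] at hP
    exact right_ne_zero_of_mul (hP ▸ HahnSeries.single_ne_zero one_ne_zero)
  refine le_antisymm ((hw j).2 ⟨0, j.2, rfl⟩) ?_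
  obtain ⟨P, hP, hdvd, hcoeff⟩ := h.exists_coeff_mul_eq hv hz hgen j
  rw [coeff_mul_of_X_pow_dvd_mul hQ0 hdvd] at hcoeff
  have hord := congrArg HahnSeries.orderTop hcoeff
  rw [HahnSeries.orderTop_mul, orderTop_single_one] at hord
  have hle := add_le_add ((h.mem_associatedOrder_iff_of_isMinDiff hv hw).1 hP j)
    ((h.mem_valRing_iff hv).1 hz ⟨0, j.pos⟩)
  rw [hord, ← WithTop.coe_add, WithTop.coe_le_coe, sub_self] at hle
  omega

theorem free_iff {w : Fin N → ℤ} (hw : IsMinDiff N (fun a => b a / N) w) :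
    Module.Free (associatedOrder κ⸨X⸩ v) (valRing v) ↔
      ∀ j : Fin N, w j = b j / N - b 0 / N := by
  refine ⟨fun _ => h.minDiff_eq_of_free hv hw, fun hwb => ?_⟩
  exact .of_equiv (LinearEquiv.ofBijective (LinearMap.toSpanSingleton (associatedOrder κ⸨X⸩ v)
    (valRing v) ⟨ρ, h.mem_valRing hv⟩) (h.bijective_smul hv hw hwb))

end PowerScaffold



section GroupAlgebra

variable {K L : Type*} [Field K] [Field L] [Algebra K L] {p : ℕ}

theorem grp_pow (σ : L ≃ₐ[K] L) (n : ℕ) : grp (σ ^ n) = grp σ ^ n := map_pow _ _ _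

theorem commute_truncPow {A : Type*} [Ring A] [Algebra K A] {a g : A} (h : Commute a g) (y : K) :
    Commute a (truncPow p g y) :=
  Commute.sum_right _ _ _ fun _ _ =>
    ((h.sub_right (Commute.one_right a)).pow_right _).smul_right _

variable [hp : Fact p.Prime]

theorem truncPow_sub_one {A : Type*} [Ring A] [Algebra K A] (g : A) (y : K) :
    truncPow p g y - 1 = (g - 1) * ∑ i ∈ Finset.range (p - 1), binom y (i + 1) • (g - 1) ^ i := by
  rw [truncPow, ← Nat.sub_add_cancel hp.out.one_le, Finset.sum_range_succ', binom_zero, pow_zero,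
    one_smul, add_sub_cancel_right, Nat.add_sub_cancel, Finset.mul_sum]
  simp only [pow_succ', mul_smul_comm]

theorem truncPow_pow_prime_eq_one {A : Type*} [Ring A] [Algebra K A] [CharP A p] {g : A}
    (hg : g ^ p = 1) (y : K) : truncPow p g y ^ p = 1 := by
  have hpow : (truncPow p g y - 1) ^ p = truncPow p g y ^ p - 1 := by
    rw [sub_pow_expChar_of_commute p (Commute.one_right _), one_pow]
  have hcomm : Commute (g - 1)
      (∑ i ∈ Finset.range (p - 1), binom y (i + 1) • (g - 1) ^ i) :=
    Commute.sum_right _ _ _ fun _ _ => ((Commute.refl _).pow_right _).smul_right _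
  rw [← sub_eq_zero, ← hpow, truncPow_sub_one, hcomm.mul_pow,
    sub_pow_expChar_of_commute p (Commute.one_right _), hg, one_pow, sub_self, zero_mul]

variable [CharP K p] {σ : L ≃ₐ[K] L} (hσ : σ ^ p ^ 2 = 1) (μ : K)

include hσ

theorem Psi₁_pow_prime : Psi₁ p σ (σ ^ p) μ ^ p = Psi₂ (σ ^ p) := by
  have : CharP (MonoidAlgebra K (L ≃ₐ[K] L)) p :=
    charP_of_injective_algebraMap (FaithfulSMul.algebraMap_injective K _) p
  have hcomm : Commute (grp σ) (truncPow p (grp (σ ^ p)) μ) :=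
    commute_truncPow (grp_pow σ p ▸ Commute.self_pow _ _) μ
  have hgrp : grp (σ ^ p) ^ p = 1 := by
    rw [← grp_pow, ← pow_mul, ← pow_two, hσ, grp, map_one]
  rw [Psi₁, sub_pow_expChar_of_commute p (Commute.one_right _), hcomm.mul_pow,
    truncPow_pow_prime_eq_one hgrp, mul_one, one_pow, Psi₂, grp_pow]

theorem Psi_eq_pow (a : ℕ) : Psi p σ (σ ^ p) μ a = Psi₁ p σ (σ ^ p) μ ^ a := by
  rw [Psi, ← Psi₁_pow_prime hσ, ← pow_mul, ← pow_add, Nat.div_add_mod]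

theorem Psi₁_pow_eq_zero : Psi₁ p σ (σ ^ p) μ ^ p ^ 2 = 0 := by
  rw [pow_two, pow_mul, Psi₁_pow_prime hσ, Psi₂_pow_prime, ← pow_mul, ← pow_two, hσ, Psi₂, grp,
    map_one, sub_self]

end GroupAlgebra

theorem dd_eq (p : ℕ) (b₁ b₂ : ℤ) (a : ℕ) :
    dd p b₁ b₂ a = bb p b₁ b₂ a / ((p ^ 2 : ℕ) : ℤ) := by
  rw [dd, ← Nat.cast_pow, Rat.floor_intCast_div_natCast]

theorem isMinDiff_ww (p : ℕ) (b₁ b₂ : ℤ) :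
    IsMinDiff (p ^ 2) (fun a => bb p b₁ b₂ a / ((p ^ 2 : ℕ) : ℤ)) (ww p b₁ b₂) := by
  simp only [← dd_eq]
  refine fun j => ⟨?_, ?_⟩
  · obtain ⟨a, ha, hmin⟩ := Finset.exists_mem_eq_inf'
      (s := Finset.range (p ^ 2 - j)) (Finset.nonempty_range_iff.2 (by omega))
      (fun a => dd p b₁ b₂ (j + a) - dd p b₁ b₂ a)
    exact ⟨a, by have := Finset.mem_range.1 ha; omega, hmin.symm⟩
  · rintro _ ⟨a, ha, rfl⟩
    exact Finset.inf'_le _ (Finset.mem_range.2 (by omega))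

namespace AdaptedGenerators

variable {p : ℕ} [hp : Fact p.Prime] {κ : Type*} [Field κ] {L : Type*} [Field L]
  [Algebra κ⸨X⸩ L] {v : AddValuation L (WithTop ℤ)} {μ : κ⸨X⸩} {b₁ b₂ : ℤ} {x y w : L}

theorem eq_of_dvd_bb_sub {σ₁ σ₂ : L ≃ₐ[κ⸨X⸩] L} (h : AdaptedGenerators p v σ₁ σ₂ μ b₁ b₂ x y w)
    {i j : ℕ} (hi : i < p ^ 2) (hj : j < p ^ 2)
    (hij : (p : ℤ) ^ 2 ∣ bb p b₁ b₂ i - bb p b₁ b₂ j) : i = j := by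
  have hdiv {a : ℕ} (ha : a < p ^ 2) : a / p < p := Nat.div_lt_of_lt_mul (by rwa [← pow_two])
  have hmod (a : ℕ) : a % p < p := Nat.mod_lt _ hp.out.pos
  obtain ⟨hq, hr⟩ := h.eq_of_dvd_sub (i := ⟨j / p, hdiv hj⟩) (j := ⟨j % p, hmod j⟩)
    (i' := ⟨i / p, hdiv hi⟩) (j' := ⟨i % p, hmod i⟩) (by
      convert hij using 1
      simp only [bb]
      ring)
  rw [← Nat.div_add_mod i p, ← Nat.div_add_mod j p, Fin.mk.inj hq, Fin.mk.inj hr]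

theorem powerScaffold [CharP κ p] [FiniteDimensional κ⸨X⸩ L] {σ : L ≃ₐ[κ⸨X⸩] L}
    (h : AdaptedGenerators p v σ (σ ^ p) μ b₁ b₂ x y w) (hv : IsFullyRamifiedValuation κ v)
    (hdeg : Module.finrank κ⸨X⸩ L = p ^ 2) (hσ : σ ^ p ^ 2 = 1) {ρ : L}
    (hρ : v ρ = ((b₂ % (p : ℤ) ^ 2 : ℤ) : WithTop ℤ)) :
    PowerScaffold v (Psi₁ p σ (σ ^ p) μ) (p ^ 2) (bb p b₁ b₂) ρ where
  finrank_eq := hdeg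
  pow_eq_zero :=
    have : CharP κ⸨X⸩ p := charP_of_injective_ringHom (HahnSeries.C : κ →+* κ⸨X⸩).injective p
    Psi₁_pow_eq_zero hσ μ
  val_pow a ha := by
    have : CharP κ⸨X⸩ p := charP_of_injective_ringHom (HahnSeries.C : κ →+* κ⸨X⸩).injective p
    rw [← Psi_eq_pow hσ, h.val_action_Psi hv hdeg hρ ha]
    simp [bb]
  incongruent i hi j hj hij := h.eq_of_dvd_bb_sub hi hj (by exact_mod_cast hij)

end AdaptedGenerators

end GaloisScaffold

end

open GaloisScaffold in
theorem lemma2p2_general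
    {p : ℕ} [Fact p.Prime]
    {κ : Type*} [Field κ] [CharP κ p]
    {L : Type*} [Field L] [Algebra κ⸨X⸩ L] [IsGalois κ⸨X⸩ L]
    (hdeg : Module.finrank κ⸨X⸩ L = p ^ 2)
    (v₂ : AddValuation L (WithTop ℤ))
    (hv₂ : IsFullyRamifiedValuation κ v₂)
    (σ₁ σ₂ : L ≃ₐ[κ⸨X⸩] L)
    (hσ₁ : ∀ τ : L ≃ₐ[κ⸨X⸩] L, τ ∈ Subgroup.zpowers σ₁)
    (hσ₂ : σ₂ = σ₁ ^ p)
    (π : L) (hπ : v₂ π = 1)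
    (b₁ b₂ : ℤ)
    (hb₁ : v₂ (σ₁ π - π) = ((b₁ + 1 : ℤ) : WithTop ℤ))
    (hb₂ : v₂ (σ₂ π - π) = ((b₂ + 1 : ℤ) : WithTop ℤ))
    (β₁ β₂ : κ⸨X⸩)
    (hβ₁ : ∀ c : κ⸨X⸩, (β₁ + (c ^ p - c)).orderTop ≤ β₁.orderTop)
    (x₁ x₂ : L)
    (hx₁ : x₁ ^ p - x₁ = algebraMap κ⸨X⸩ L β₁)
    (hx₂ : x₂ ^ p - x₂ = wittPoly p x₁ (algebraMap κ⸨X⸩ L β₁) + algebraMap κ⸨X⸩ L β₂)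
    (hσx₁ : σ₁ x₁ - x₁ = 1)
    (hσx₂ : σ₁ x₂ - x₂ = wittPoly p x₁ 1)
    (μ ε : κ⸨X⸩)
    (hμε : β₂ = μ ^ p * β₁ + ε)
    (hcond₁ : p • β₂.orderTop + ((((p : ℤ) - 1) * b₁ : ℤ) : WithTop ℤ) < p • ε.orderTop)
    (hcond₂ : p • β₂.orderTop + ((((p : ℤ) - 1) * b₁ : ℤ) : WithTop ℤ) <
      p • (β₁ ^ p).orderTop) :
    (LinearIndependent κ⟦X⟧ (fun j : Fin (p ^ 2) =>
        ((HahnSeries.single (1 : ℤ) (1 : κ) : κ⸨X⸩) ^ (-ww p b₁ b₂ j)) • Psi p σ₁ σ₂ μ j) ∧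
      (Submodule.span κ⟦X⟧ (Set.range (fun j : Fin (p ^ 2) =>
        ((HahnSeries.single (1 : ℤ) (1 : κ) : κ⸨X⸩) ^ (-ww p b₁ b₂ j)) • Psi p σ₁ σ₂ μ j)) :
          Set (MonoidAlgebra κ⸨X⸩ (L ≃ₐ[κ⸨X⸩] L))) =
        associatedOrder κ⸨X⸩ v₂) ∧
    (Module.Free (associatedOrder κ⸨X⸩ v₂) (valRing v₂) ↔
      ∀ j : Fin (p ^ 2), ww p b₁ b₂ j = dd p b₁ b₂ j - dd p b₁ b₂ 0) ∧
    (Module.Free (associatedOrder κ⸨X⸩ v₂) (valRing v₂) →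
      ∀ ρ : L, v₂ ρ = ((b₂ % (p : ℤ) ^ 2 : ℤ) : WithTop ℤ) →
        ∃ hρ : ρ ∈ valRing v₂,
          Function.Bijective (fun α : associatedOrder κ⸨X⸩ v₂ =>
            α • (⟨ρ, hρ⟩ : valRing v₂))) := by
  subst hσ₂
  have : FiniteDimensional κ⸨X⸩ L :=
    Module.finite_of_finrank_pos (hdeg ▸ pow_pos (Fact.out : p.Prime).pos 2)
  have : CharP κ⸨X⸩ p := charP_of_injective_ringHom (HahnSeries.C : κ →+* κ⸨X⸩).injective p
  have hord : σ₁ ^ p ^ 2 = 1 := by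
    rw [← hdeg, ← IsGalois.card_aut_eq_finrank κ⸨X⸩ L, pow_card_eq_one']
  have hgen := hv₂.adaptedGenerators hdeg hσ₁ hπ hb₁ hb₂ hβ₁ hx₁ hx₂ hσx₁ hσx₂ hμε hcond₁ hcond₂
  have hscaf {ρ : L} (hρ : v₂ ρ = ((b₂ % (p : ℤ) ^ 2 : ℤ) : WithTop ℤ)) :=
    hgen.powerScaffold hv₂ hdeg hord hρ
  have hw := isMinDiff_ww p b₁ b₂
  obtain ⟨ρ₀, hρ₀⟩ := hv₂.normalized (b₂ % (p : ℤ) ^ 2)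
  simp only [← RatFunc.single_zpow, Psi_eq_pow hord μ, dd_eq]
  exact ⟨⟨(hscaf hρ₀).linearIndependent_single_smul_pow hv₂ _,
      (hscaf hρ₀).span_single_smul_pow hv₂ hw⟩,
    (hscaf hρ₀).free_iff hv₂ hw,
    fun _ ρ hρ => ⟨(hscaf hρ).mem_valRing hv₂,
      (hscaf hρ).bijective_smul hv₂ hw ((hscaf hρ₀).minDiff_eq_of_free hv₂ hw)⟩⟩

theorem lemma2p2
    {p : ℕ} [Fact p.Prime]
    {κ : Type*} [Field κ] [CharP κ p] [PerfectField κ]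
    {L : Type*} [Field L] [Algebra κ⸨X⸩ L] [IsGalois κ⸨X⸩ L]
    -- a fully ramified Galois extension of degree `p²` with normalized valuation `v₂`
    (hdeg : Module.finrank κ⸨X⸩ L = p ^ 2)
    (v₂ : AddValuation L (WithTop ℤ))
    (hv₂ : GaloisScaffold.IsFullyRamifiedValuation κ v₂)
    -- the Galois group is cyclic, generated by `σ₁`, and `σ₂ = σ₁ ^ p`
    (σ₁ σ₂ : L ≃ₐ[κ⸨X⸩] L)
    (hσ₁ : ∀ τ : L ≃ₐ[κ⸨X⸩] L, τ ∈ Subgroup.zpowers σ₁)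
    (hσ₂ : σ₂ = σ₁ ^ p)
    -- the lower ramification numbers
    (π : L) (hπ : v₂ π = 1)
    (b₁ b₂ : ℤ)
    (hb₁ : v₂ (σ₁ π - π) = ((b₁ + 1 : ℤ) : WithTop ℤ))
    (hb₂ : v₂ (σ₂ π - π) = ((b₂ + 1 : ℤ) : WithTop ℤ))
    -- the Witt vector `(β₁, β₂)`, reduced, and the Artin-Schreier-Witt generators
    (β₁ β₂ : κ⸨X⸩)
    (hβ₁ : ∀ c : κ⸨X⸩, (β₁ + (c ^ p - c)).orderTop ≤ β₁.orderTop)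
    (hβ₂ : ∀ (n : ℤ) (c : κ⸨X⸩), (β₂ + (n * β₁ + (c ^ p - c))).orderTop ≤ β₂.orderTop)
    (x₁ x₂ : L)
    (hx₁ : x₁ ^ p - x₁ = algebraMap κ⸨X⸩ L β₁)
    (hx₂ : x₂ ^ p - x₂ =
      GaloisScaffold.wittPoly p x₁ (algebraMap κ⸨X⸩ L β₁) + algebraMap κ⸨X⸩ L β₂)
    (hσx₁ : σ₁ x₁ - x₁ = 1)
    (hσx₂ : σ₁ x₂ - x₂ = GaloisScaffold.wittPoly p x₁ 1)
    -- `β₂ = μ^p β₁ + ε`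
    (μ ε : κ⸨X⸩)
    (hμε : β₂ = μ ^ p * β₁ + ε)
    (hε : (∃ c : κ, ε = HahnSeries.C c) ∨
      ∃ e : ℤ, 0 < e ∧ ε.orderTop = ((-e : ℤ) : WithTop ℤ) ∧ ¬ (p : ℤ) ∣ e ∧
        ¬ e ≡ b₁ [ZMOD p])
    -- `v₀(ε) > v₀(β₂) + (p-1) b₁ / p` and `v₀(β₁^p) > v₀(β₂) + (p-1) b₁ / p`
    (hcond₁ : p • β₂.orderTop + ((((p : ℤ) - 1) * b₁ : ℤ) : WithTop ℤ) < p • ε.orderTop)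
    (hcond₂ : p • β₂.orderTop + ((((p : ℤ) - 1) * b₁ : ℤ) : WithTop ℤ) <
      p • (β₁ ^ p).orderTop) :
    -- `{t^{-w_j} Ψ^(j)}` is an `𝔒₀`-basis of the associated order
    (LinearIndependent κ⟦X⟧ (fun j : Fin (p ^ 2) =>
        ((HahnSeries.single (1 : ℤ) (1 : κ) : κ⸨X⸩) ^ (-GaloisScaffold.ww p b₁ b₂ j)) •
          GaloisScaffold.Psi p σ₁ σ₂ μ j) ∧
      (Submodule.span κ⟦X⟧ (Set.range (fun j : Fin (p ^ 2) =>
        ((HahnSeries.single (1 : ℤ) (1 : κ) : κ⸨X⸩) ^ (-GaloisScaffold.ww p b₁ b₂ j)) •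
          GaloisScaffold.Psi p σ₁ σ₂ μ j)) : Set (MonoidAlgebra κ⸨X⸩ (L ≃ₐ[κ⸨X⸩] L))) =
        GaloisScaffold.associatedOrder κ⸨X⸩ v₂) ∧
    -- `𝔒₂` is free over the associated order iff `w_j = d_j - d_0` for all `j`
    (Module.Free (GaloisScaffold.associatedOrder κ⸨X⸩ v₂) (GaloisScaffold.valRing v₂) ↔
      ∀ j : Fin (p ^ 2), GaloisScaffold.ww p b₁ b₂ j =
        GaloisScaffold.dd p b₁ b₂ j - GaloisScaffold.dd p b₁ b₂ 0) ∧
    -- in that case every `ρ` with `v₂(ρ) = r(b₂)` is a free generator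
    (Module.Free (GaloisScaffold.associatedOrder κ⸨X⸩ v₂) (GaloisScaffold.valRing v₂) →
      ∀ ρ : L, v₂ ρ = ((b₂ % (p : ℤ) ^ 2 : ℤ) : WithTop ℤ) →
        ∃ hρ : ρ ∈ GaloisScaffold.valRing v₂,
          Function.Bijective (fun α : GaloisScaffold.associatedOrder κ⸨X⸩ v₂ =>
            α • (⟨ρ, hρ⟩ : GaloisScaffold.valRing v₂))) := by
  exact lemma2p2_general hdeg v₂ hv₂ σ₁ σ₂ hσ₁ hσ₂ π hπ b₁ b₂ hb₁ hb₂ β₁ β₂ hβ₁ x₁ x₂ hx₁ hx₂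
    hσx₁ hσx₂ μ ε hμε hcond₁ hcond₂
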